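/- Let $d\ge 2$ be an integer, $q\in(1,2)$ and $\mu>0$. Let $L_\mu$ be the self-adjoint operator in the complex Hilbert space $L^2(0,\infty)$ obtained as the Friedrichs extension of the densely defined, symmetric, lower semibounded operator $$C_c^\infty(0,\infty)\ni f\mapsto -f''+V_\mu f,\qquad V_\mu(s):=\frac{q^2(d-1)^2-2q(d-1)}{4s^2}-\frac{\mu}{s^q}.$$ Then $L_\mu$ has infinitely many negative eigenvalues; that is, the set of real numbers $E<0$ for which there is a nonzero $f$ in the domain of $L_\mu$ with $L_\mu f=Ef$ is infinite. -/

import Mathlib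

open MeasureTheory Set Filter Topology TopologicalSpace
open scoped Distributions ComplexConjugate

noncomputable section

section AbstractOperators

variable {𝕜 H : Type*} [RCLike 𝕜] [NormedAddCommGroup H] [InnerProductSpace 𝕜 H]

/-- A densely defined symmetric operator which is bounded from below. -/
structure LinearPMap.IsSemibounded (T : H →ₗ.[𝕜] H) : Prop where
  dense : Dense (T.domain : Set H)
  symm : T.IsFormalAdjoint T
  lower_bound : ∃ c : ℝ, ∀ x : T.domain, c * ‖(x : H)‖ ^ 2 ≤ RCLike.re (inner 𝕜 (x : H) (T x))

/-- The quadratic form `x ↦ ⟨x, T x⟩` of an operator (real part, which is all of it when `T` is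
symmetric). -/
def LinearPMap.quadForm (T : H →ₗ.[𝕜] H) (x : T.domain) : ℝ :=
  RCLike.re (inner 𝕜 (x : H) (T x))

theorem LinearPMap.quadForm_parallelogram (T : H →ₗ.[𝕜] H) (x y : T.domain) :
    T.quadForm (x + y) + T.quadForm (x - y) = 2 * (T.quadForm x + T.quadForm y) := by
  simp only [LinearPMap.quadForm, LinearPMap.map_add, LinearPMap.map_sub, Submodule.coe_add,
    Submodule.coe_sub, inner_add_left, inner_add_right, inner_sub_left, inner_sub_right,
    _root_.map_add, _root_.map_sub]
  ring

theorem LinearPMap.quadForm_smul (T : H →ₗ.[𝕜] H) (a : 𝕜) (x : T.domain) :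
    T.quadForm (a • x) = ‖a‖ ^ 2 * T.quadForm x := by
  simp only [LinearPMap.quadForm, LinearPMap.map_smul, Submodule.coe_smul, inner_smul_left,
    inner_smul_right]
  rw [← mul_assoc, RCLike.mul_conj]
  rw [← RCLike.ofReal_pow, RCLike.re_ofReal_mul]

/-- The form domain of a semibounded operator `T`: the domain of the closure of its quadratic
form. It consists of the limits in `H` of those sequences in `T.domain` which are Cauchy for the
quadratic form. -/
def LinearPMap.formDomain (T : H →ₗ.[𝕜] H) (hT : T.IsSemibounded) : Submodule 𝕜 H where
  carrier := {u | ∃ x : ℕ → T.domain, Tendsto (fun n => (x n : H)) atTop (𝓝 u) ∧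
    Tendsto (fun p : ℕ × ℕ => T.quadForm (x p.1 - x p.2)) atTop (𝓝 0)}
  zero_mem' := ⟨fun _ => 0, by simp, by simp [LinearPMap.quadForm]⟩
  smul_mem' := by
    rintro a u ⟨x, hx, hx'⟩
    refine ⟨fun n => a • x n, ?_, ?_⟩
    · simpa using hx.const_smul a
    · have := hx'.const_mul (‖a‖ ^ 2)
      simpa only [← smul_sub, LinearPMap.quadForm_smul, mul_zero] using this
  add_mem' := by
    rintro u v ⟨x, hx, hx'⟩ ⟨y, hy, hy'⟩
    refine ⟨fun n => x n + y n, by simpa using hx.add hy, ?_⟩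
    obtain ⟨c, hc⟩ := hT.lower_bound
    have cauchy : ∀ {z : ℕ → T.domain} {w : H}, Tendsto (fun n => (z n : H)) atTop (𝓝 w) →
        Tendsto (fun p : ℕ × ℕ => (z p.1 : H) - z p.2) atTop (𝓝 0) := by
      intro z w hz
      have h1 := hz.comp (tendsto_fst (f := (atTop : Filter ℕ)) (g := (atTop : Filter ℕ)))
      have h2 := hz.comp (tendsto_snd (f := (atTop : Filter ℕ)) (g := (atTop : Filter ℕ)))
      have h3 := h1.sub h2
      rw [prod_atTop_atTop_eq] at h3
      simpa [Function.comp_def] using h3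
    have hs := ((cauchy hx).add (cauchy hy)).norm.pow 2
    have hd := ((cauchy hx).sub (cauchy hy)).norm.pow 2
    refine tendsto_of_tendsto_of_tendsto_of_le_of_le
      (g := fun p : ℕ × ℕ => c * ‖((x p.1 : H) - x p.2) + (y p.1 - y p.2)‖ ^ 2)
      (h := fun p : ℕ × ℕ => 2 * (T.quadForm (x p.1 - x p.2) + T.quadForm (y p.1 - y p.2))
        - c * ‖((x p.1 : H) - x p.2) - (y p.1 - y p.2)‖ ^ 2) ?_ ?_ ?_ ?_
    · simpa using hs.const_mul c
    · simpa using ((hx'.add hy').const_mul 2).sub (hd.const_mul c)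
    · intro p
      have h := hc ((x p.1 - x p.2) + (y p.1 - y p.2))
      have e : (x p.1 + y p.1) - (x p.2 + y p.2) = (x p.1 - x p.2) + (y p.1 - y p.2) := by abel
      simp only [e]
      simpa [LinearPMap.quadForm] using h
    · intro p
      have h := hc ((x p.1 - x p.2) - (y p.1 - y p.2))
      have e : (x p.1 + y p.1) - (x p.2 + y p.2) = (x p.1 - x p.2) + (y p.1 - y p.2) := by abel
      have h2 := T.quadForm_parallelogram (x p.1 - x p.2) (y p.1 - y p.2)
      have h3 : c * ‖((x p.1 : H) - x p.2) - (y p.1 - y p.2)‖ ^ 2 ≤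
          T.quadForm ((x p.1 - x p.2) - (y p.1 - y p.2)) := by
        simpa [LinearPMap.quadForm] using h
      simp only [e]
      linarith

/-- The Friedrichs extension of a semibounded operator `T`: the restriction of the adjoint `T†` to
those elements of its domain which lie in the form domain of `T`. -/
def LinearPMap.friedrichsExtension [CompleteSpace H] (T : H →ₗ.[𝕜] H) (hT : T.IsSemibounded) :
    H →ₗ.[𝕜] H :=
  T.adjoint.domRestrict (T.formDomain hT)

/-- `z` is an eigenvalue of the (unbounded) operator `A`. -/
def LinearPMap.HasEigenvalue (A : H →ₗ.[𝕜] H) (z : 𝕜) : Prop :=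
  ∃ u : A.domain, (u : H) ≠ 0 ∧ A u = z • (u : H)

end AbstractOperators

section SchrodingerOperator

/-- The open half-line `(0, ∞)`. -/
def halfLine : Opens ℝ := ⟨Ioi 0, isOpen_Ioi⟩

/-- Lebesgue measure on `(0, ∞)`. -/
abbrev halfLineMeasure : Measure ℝ := volume.restrict (Ioi 0)

/-- The complex Hilbert space `L²(0, ∞)`. -/
abbrev HalfLineL2 : Type := Lp ℂ 2 halfLineMeasure

/-- The potential `(q²(d-1)² - 2q(d-1)) / (4s²) - μ / s^q`. -/
def peakPotential (d : ℕ) (q μ s : ℝ) : ℝ :=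
  (q ^ 2 * ((d : ℝ) - 1) ^ 2 - 2 * q * ((d : ℝ) - 1)) / (4 * s ^ 2) - μ / s ^ q

/-- The differential expression `-f'' + V f`. -/
def schrodingerExpr (V : ℝ → ℝ) (f : ℝ → ℂ) (s : ℝ) : ℂ :=
  -deriv (deriv f) s + (V s : ℂ) * f s

theorem peakPotential_continuousAt (d : ℕ) (q μ : ℝ) {s : ℝ} (hs : 0 < s) :
    ContinuousAt (peakPotential d q μ) s := by
  unfold peakPotential
  have h1 : s ^ q ≠ 0 := (Real.rpow_pos_of_pos hs q).ne'
  have h2 : 4 * s ^ 2 ≠ 0 := by positivity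
  have h3 : ContinuousAt (fun t : ℝ => t ^ q) s :=
    Real.continuousAt_rpow_const _ _ (Or.inl hs.ne')
  have h4 : ContinuousAt (fun t : ℝ => 4 * t ^ 2) s := by fun_prop
  exact (continuousAt_const.div h4 h2).sub (continuousAt_const.div h3 h1)

theorem TestFunction.hasDerivAt_one (f : 𝓓(halfLine, ℂ)) (s : ℝ) :
    HasDerivAt f (deriv f s) s :=
  ((f.contDiff.differentiable (by simp)) s).hasDerivAt

theorem TestFunction.contDiff_deriv (f : 𝓓(halfLine, ℂ)) : ContDiff ℝ 1 (deriv f) := by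
  have h : ContDiff ℝ (1 + 1) f := f.contDiff.of_le (by
    have : ((2 : ℕ∞) : WithTop ℕ∞) ≤ ((⊤ : ℕ∞) : WithTop ℕ∞) := by exact_mod_cast le_top
    exact le_trans (by norm_num) this)
  exact (contDiff_succ_iff_deriv.1 h).2.2

theorem TestFunction.hasDerivAt_two (f : 𝓓(halfLine, ℂ)) (s : ℝ) :
    HasDerivAt (deriv f) (deriv (deriv f) s) s :=
  ((f.contDiff_deriv.differentiable (by simp)) s).hasDerivAt

theorem TestFunction.continuous_deriv_two (f : 𝓓(halfLine, ℂ)) :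
    Continuous (deriv (deriv f)) :=
  f.contDiff_deriv.continuous_deriv (le_refl _)

theorem TestFunction.pos_of_mem (f : 𝓓(halfLine, ℂ)) {s : ℝ} (hs : s ∈ tsupport f) : 0 < s :=
  f.tsupport_subset hs

theorem TestFunction.eq_zero_off (f : 𝓓(halfLine, ℂ)) {s : ℝ} (hs : s ∉ tsupport f) :
    f s = 0 := image_eq_zero_of_notMem_tsupport hs

theorem TestFunction.deriv_eq_zero_off (f : 𝓓(halfLine, ℂ)) {s : ℝ} (hs : s ∉ tsupport f) :
    deriv f s = 0 := by
  by_contra h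
  exact hs (support_deriv_subset h)

theorem TestFunction.deriv_two_eq_zero_off (f : 𝓓(halfLine, ℂ)) {s : ℝ} (hs : s ∉ tsupport f) :
    deriv (deriv f) s = 0 := by
  by_contra h
  have h1 : tsupport (deriv f) ⊆ tsupport f :=
    closure_minimal support_deriv_subset (isClosed_tsupport _)
  exact hs (h1 (support_deriv_subset h))

theorem TestFunction.memLp_halfLine (f : 𝓓(halfLine, ℂ)) : MemLp f 2 halfLineMeasure :=
  (f.continuous.memLp_of_hasCompactSupport f.hasCompactSupport)

theorem TestFunction.continuous_schrodingerExpr (d : ℕ) (q μ : ℝ) (f : 𝓓(halfLine, ℂ)) :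
    Continuous (schrodingerExpr (peakPotential d q μ) f) := by
  unfold schrodingerExpr
  refine f.continuous_deriv_two.neg.add ?_
  refine continuous_of_tsupport fun s hs => ?_
  have hs' : 0 < s := f.pos_of_mem
    (closure_mono (Function.support_mul_subset_right _ _) hs)
  exact (Complex.continuous_ofReal.continuousAt.comp (peakPotential_continuousAt d q μ hs')).mul
    f.continuous.continuousAt

theorem TestFunction.schrodingerExpr_eq_zero_off (V : ℝ → ℝ) (f : 𝓓(halfLine, ℂ)) {s : ℝ}
    (hs : s ∉ tsupport f) : schrodingerExpr V f s = 0 := by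
  simp [schrodingerExpr, f.eq_zero_off hs, f.deriv_two_eq_zero_off hs]

theorem TestFunction.memLp_schrodingerExpr (d : ℕ) (q μ : ℝ) (f : 𝓓(halfLine, ℂ)) :
    MemLp (schrodingerExpr (peakPotential d q μ) f) 2 halfLineMeasure :=
  (f.continuous_schrodingerExpr d q μ).memLp_of_hasCompactSupport
    (HasCompactSupport.intro f.hasCompactSupport
      fun _ hs => f.schrodingerExpr_eq_zero_off _ hs)

/-- The inclusion of the test functions `C_c^∞(0, ∞)` into `L²(0, ∞)`. -/
def testToL2 : 𝓓(halfLine, ℂ) →ₗ[ℂ] HalfLineL2 where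
  toFun f := f.memLp_halfLine.toLp f
  map_add' f g := MemLp.toLp_add f.memLp_halfLine g.memLp_halfLine
  map_smul' c f := MemLp.toLp_const_smul c f.memLp_halfLine

theorem testToL2_injective : Function.Injective testToL2 := by
  intro f g hfg
  have h : (f : ℝ → ℂ) =ᵐ[halfLineMeasure] g :=
    (MemLp.toLp_eq_toLp_iff f.memLp_halfLine g.memLp_halfLine).1 hfg
  ext s
  by_cases hs : 0 < s
  · exact Measure.eqOn_open_of_ae_eq h isOpen_Ioi f.continuous.continuousOn
      g.continuous.continuousOn hs
  · rw [f.eq_zero_off fun h => hs (f.pos_of_mem h), g.eq_zero_off fun h => hs (g.pos_of_mem h)]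

/-- The map `f ↦ -f'' + V f` from the test functions to `L²(0, ∞)`. -/
def schrodingerToL2 (d : ℕ) (q μ : ℝ) : 𝓓(halfLine, ℂ) →ₗ[ℂ] HalfLineL2 where
  toFun f := (f.memLp_schrodingerExpr d q μ).toLp _
  map_add' f g := by
    rw [← MemLp.toLp_add]
    congr 1
    funext s
    have h1 : deriv (⇑(f + g)) = deriv f + deriv g := by
      funext t
      exact ((f.hasDerivAt_one t).add (g.hasDerivAt_one t)).deriv
    have h2 : deriv (deriv (⇑(f + g))) s = deriv (deriv f) s + deriv (deriv g) s := by
      rw [h1]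
      exact ((f.hasDerivAt_two s).add (g.hasDerivAt_two s)).deriv
    have h3 : (f + g) s = f s + g s := rfl
    simp only [schrodingerExpr, Pi.add_apply, h2, h3]
    ring
  map_smul' c f := by
    rw [RingHom.id_apply, ← MemLp.toLp_const_smul]
    congr 1
    funext s
    have h1 : deriv (⇑(c • f)) = c • deriv f := by
      funext t
      exact ((f.hasDerivAt_one t).const_smul c).deriv
    have h2 : deriv (deriv (⇑(c • f))) s = c * deriv (deriv f) s := by
      rw [h1]
      exact ((f.hasDerivAt_two s).const_smul c).deriv
    have h3 : (c • f) s = c * f s := rfl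
    simp only [schrodingerExpr, Pi.smul_apply, smul_eq_mul, h2, h3]
    ring

/-- The operator `C_c^∞(0, ∞) ∋ f ↦ -f'' + V f` in `L²(0, ∞)`, with `V = peakPotential d q μ`. -/
def minimalOp (d : ℕ) (q μ : ℝ) : HalfLineL2 →ₗ.[ℂ] HalfLineL2 where
  domain := LinearMap.range testToL2
  toFun := schrodingerToL2 d q μ ∘ₗ (LinearEquiv.ofInjective testToL2 testToL2_injective).symm

theorem minimalOp_apply (d : ℕ) (q μ : ℝ) (f : 𝓓(halfLine, ℂ)) :
    minimalOp d q μ ⟨testToL2 f, ⟨f, rfl⟩⟩ = schrodingerToL2 d q μ f := by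
  change schrodingerToL2 d q μ ((LinearEquiv.ofInjective testToL2 testToL2_injective).symm _) = _
  exact congrArg _ ((LinearEquiv.ofInjective testToL2 testToL2_injective).symm_apply_apply f)

theorem integrableOn_halfLine_of_off {K : Set ℝ} (hK : IsCompact K) (hK0 : K ⊆ Ioi 0)
    {E : Type*} [NormedAddCommGroup E] {h : ℝ → E}
    (hc : ContinuousOn h (Ioi 0)) (h0 : ∀ s, s ∉ K → h s = 0) : IntegrableOn h (Ioi 0) := by
  refine ((hc.mono hK0).integrableOn_compact hK).of_forall_sdiff_eq_zero measurableSet_Ioi ?_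
  exact fun s hs => h0 s hs.2

theorem integral_halfLine_deriv_eq_zero {K : Set ℝ} (hK : IsCompact K) (hK0 : K ⊆ Ioi 0)
    {E : Type*} [NormedAddCommGroup E] [NormedSpace ℝ E] [CompleteSpace E] {h h' : ℝ → E}
    (hh : ∀ s, 0 < s → HasDerivAt h (h' s) s) (hc : ContinuousOn h' (Ioi 0))
    (h0 : ∀ s, s ∉ K → h s = 0) (h0' : ∀ s, s ∉ K → h' s = 0) :
    ∫ s in Ioi (0 : ℝ), h' s = 0 := by
  have hz : (0 : ℝ) ∉ K := fun hz => lt_irrefl (0 : ℝ) (hK0 hz)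
  have e0 : h =ᶠ[𝓝 0] fun _ => 0 := by
    filter_upwards [hK.isClosed.isOpen_compl.mem_nhds hz] with s hs using h0 s hs
  have e1 : h =ᶠ[atTop] fun _ => 0 := by
    obtain ⟨b, hb⟩ := hK.bddAbove
    filter_upwards [eventually_gt_atTop b] with s hs
    exact h0 s fun hsK => absurd (hb hsK) (not_le.2 hs)
  have := integral_Ioi_of_hasDerivAt_of_tendsto (f := h) (f' := h') (a := 0) (m := 0)
    ((continuousAt_const.congr e0.symm).continuousWithinAt) (fun s hs => hh s hs)
    (integrableOn_halfLine_of_off hK hK0 hc h0') (tendsto_const_nhds.congr' e1.symm)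
  rw [this, h0 0 hz, sub_zero]

theorem inner_halfLine_toLp {f g : ℝ → ℂ} (hf : MemLp f 2 halfLineMeasure)
    (hg : MemLp g 2 halfLineMeasure) :
    inner ℂ (hf.toLp f) (hg.toLp g) = ∫ s in Ioi (0 : ℝ), conj (f s) * g s := by
  rw [L2.inner_def]
  refine integral_congr_ae ?_
  filter_upwards [hf.coeFn_toLp, hg.coeFn_toLp] with s h1 h2
  rw [h1, h2, RCLike.inner_apply, mul_comm]

theorem minimalOp_dense (d : ℕ) (q μ : ℝ) :
    Dense ((minimalOp d q μ).domain : Set HalfLineL2) := by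
  rw [Submodule.dense_iff_topologicalClosure_eq_top, Submodule.topologicalClosure_eq_top_iff,
    Submodule.eq_bot_iff]
  intro u hu
  have hl : LocallyIntegrable u halfLineMeasure := (Lp.memLp u).locallyIntegrable (by norm_num)
  have key : ∀ᵐ s ∂(volume : Measure ℝ), s ∈ Ioi (0 : ℝ) → u s = 0 := by
    refine isOpen_Ioi.ae_eq_zero_of_integral_contDiff_smul_eq_zero ?_ ?_
    · rw [locallyIntegrableOn_iff isOpen_Ioi.isLocallyClosed]
      intro K hK hKc
      have := hl.integrableOn_isCompact hKc
      rwa [IntegrableOn, Measure.restrict_restrict hKc.measurableSet,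
        inter_eq_left.2 hK] at this
    · intro g hg hgc hgs
      let G : 𝓓(halfLine, ℂ) := ⟨fun s => (g s : ℂ),
        Complex.ofRealCLM.contDiff.comp hg, hgc.comp_left Complex.ofReal_zero,
        (closure_mono (Function.support_comp_subset Complex.ofReal_zero g)).trans hgs⟩
      have h := (Submodule.mem_orthogonal _ u).1 hu (testToL2 G) ⟨G, rfl⟩
      have h2 : inner ℂ (testToL2 G) u = ∫ s in Ioi (0 : ℝ), conj (G s) * u s := by
        rw [L2.inner_def]
        refine integral_congr_ae ?_
        filter_upwards [G.memLp_halfLine.coeFn_toLp] with s h1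
        change inner ℂ ((G.memLp_halfLine.toLp G) s) (u s) = _
        rw [h1, RCLike.inner_apply, mul_comm]
      rw [h2] at h
      rw [← h, ← setIntegral_eq_integral_of_forall_compl_eq_zero (s := Ioi (0 : ℝ))]
      · refine setIntegral_congr_fun measurableSet_Ioi fun s _ => ?_
        change g s • u s = conj ((g s : ℂ)) * u s
        rw [Complex.conj_ofReal, Complex.real_smul]
      · intro s hs
        rw [image_eq_zero_of_notMem_tsupport fun h => hs (hgs h), zero_smul]
  rw [Lp.eq_zero_iff_ae_eq_zero]
  exact (ae_restrict_iff' measurableSet_Ioi).2 key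

theorem minimalOp_symm (d : ℕ) (q μ : ℝ) :
    (minimalOp d q μ).IsFormalAdjoint (minimalOp d q μ) := by
  rintro ⟨_, f, rfl⟩ ⟨_, g, rfl⟩
  rw [minimalOp_apply, minimalOp_apply]
  change inner ℂ ((f.memLp_schrodingerExpr d q μ).toLp _) (g.memLp_halfLine.toLp g) =
    inner ℂ (f.memLp_halfLine.toLp f) ((g.memLp_schrodingerExpr d q μ).toLp _)
  rw [inner_halfLine_toLp, inner_halfLine_toLp, ← sub_eq_zero, ← integral_sub]
  · set W : ℝ → ℂ := fun s => conj (f s) * deriv g s - conj (deriv f s) * g s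
    refine integral_halfLine_deriv_eq_zero (h := W) f.hasCompactSupport f.tsupport_subset
      ?_ ?_ ?_ ?_
    · intro s _
      have h := (((f.hasDerivAt_one s).star).mul (g.hasDerivAt_two s)).sub
        (((f.hasDerivAt_two s).star).mul (g.hasDerivAt_one s))
      refine h.congr_deriv ?_
      simp only [schrodingerExpr, map_add, map_neg, map_mul, Complex.conj_ofReal,
        Complex.star_def]
      ring
    · exact (((Complex.continuous_conj.comp (f.continuous_schrodingerExpr d q μ)).mul
        g.continuous).sub ((Complex.continuous_conj.comp f.continuous).mul
          (g.continuous_schrodingerExpr d q μ))).continuousOn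
    · intro s hs
      simp [W, f.eq_zero_off hs, f.deriv_eq_zero_off hs]
    · intro s hs
      simp [f.eq_zero_off hs, f.schrodingerExpr_eq_zero_off _ hs]
  · refine integrableOn_halfLine_of_off f.hasCompactSupport f.tsupport_subset
      (((Complex.continuous_conj.comp (f.continuous_schrodingerExpr d q μ)).mul
        g.continuous).continuousOn) fun s hs => ?_
    simp [f.schrodingerExpr_eq_zero_off _ hs]
  · refine integrableOn_halfLine_of_off f.hasCompactSupport f.tsupport_subset
      (((Complex.continuous_conj.comp f.continuous).mul
        (g.continuous_schrodingerExpr d q μ)).continuousOn) fun s hs => ?_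
    simp [f.eq_zero_off hs]

/-- The potential is bounded from below by the Hardy weight `-1/(4s²)` up to a constant. -/
theorem peakPotential_lower_bound {d : ℕ} (hd : 2 ≤ d) {q : ℝ} (hq1 : 1 < q) (hq2 : q < 2)
    {μ : ℝ} (hμ : 0 < μ) :
    ∃ C : ℝ, ∀ s : ℝ, 0 < s → -1 / (4 * s ^ 2) - C ≤ peakPotential d q μ s := by
  have hd' : (1 : ℝ) ≤ (d : ℝ) - 1 := by
    have : (2 : ℝ) ≤ d := by exact_mod_cast hd
    linarith
  set p : ℝ := q * ((d : ℝ) - 1) with hp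
  have hp1 : 1 < p := by nlinarith
  set ε : ℝ := (p - 1) ^ 2 / 4 with hε
  have hε0 : 0 < ε := by
    have : 0 < p - 1 := by linarith
    positivity
  set s0 : ℝ := (ε / μ) ^ (1 / (2 - q)) with hs0
  have hs0p : 0 < s0 := by positivity
  refine ⟨μ / s0 ^ q, fun s hs => ?_⟩
  have e : peakPotential d q μ s = -1 / (4 * s ^ 2) + ε / s ^ 2 - μ / s ^ q := by
    unfold peakPotential
    have : q ^ 2 * ((d : ℝ) - 1) ^ 2 - 2 * q * ((d : ℝ) - 1) = p ^ 2 - 2 * p := by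
      rw [hp]; ring
    rw [this, hε]
    field_simp
    ring
  have hC : 0 < μ / s0 ^ q := by positivity
  have hE : 0 < ε / s ^ 2 := by positivity
  have : μ / s ^ q ≤ ε / s ^ 2 + μ / s0 ^ q := by
    rcases le_total s s0 with h | h
    · have h1 : s ^ (2 - q) ≤ ε / μ := by
        calc s ^ (2 - q) ≤ s0 ^ (2 - q) := Real.rpow_le_rpow hs.le h (by linarith)
          _ = ε / μ := by
            rw [hs0, ← Real.rpow_mul (by positivity), one_div_mul_cancel (by linarith),
              Real.rpow_one]
      have h2 : s ^ (2 - q) * s ^ q = s ^ 2 := by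
        rw [← Real.rpow_add hs, ← Real.rpow_natCast]
        norm_num
      have h3 : 0 < s ^ q := by positivity
      have h4 : μ / s ^ q ≤ ε / s ^ 2 := by
        rw [div_le_div_iff₀ h3 (by positivity), ← h2]
        rw [le_div_iff₀ hμ] at h1
        nlinarith
      linarith
    · have : μ / s ^ q ≤ μ / s0 ^ q :=
        div_le_div_of_nonneg_left hμ.le (by positivity)
          (Real.rpow_le_rpow hs0p.le h (by linarith))
      linarith
  rw [e]
  linarith

theorem minimalOp_lower_bound {d : ℕ} (hd : 2 ≤ d) {q : ℝ} (hq1 : 1 < q) (hq2 : q < 2)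
    {μ : ℝ} (hμ : 0 < μ) :
    ∃ c : ℝ, ∀ x : (minimalOp d q μ).domain,
      c * ‖(x : HalfLineL2)‖ ^ 2 ≤ RCLike.re (inner ℂ (x : HalfLineL2) (minimalOp d q μ x)) := by
  obtain ⟨C, hC⟩ := peakPotential_lower_bound hd hq1 hq2 hμ
  refine ⟨-C, ?_⟩
  rintro ⟨_, f, rfl⟩
  rw [minimalOp_apply]
  have hn : ‖testToL2 f‖ ^ 2 = RCLike.re (inner ℂ (testToL2 f) (testToL2 f)) :=
    norm_sq_eq_re_inner _
  rw [hn]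
  change -C * RCLike.re (inner ℂ (f.memLp_halfLine.toLp f) (f.memLp_halfLine.toLp f)) ≤
    RCLike.re (inner ℂ (f.memLp_halfLine.toLp f) ((f.memLp_schrodingerExpr d q μ).toLp _))
  rw [inner_halfLine_toLp, inner_halfLine_toLp]
  have c1 : Continuous fun s => conj (f s) * f s :=
    (Complex.continuous_conj.comp f.continuous).mul f.continuous
  have c2 : Continuous fun s => conj (f s) * schrodingerExpr (peakPotential d q μ) f s :=
    (Complex.continuous_conj.comp f.continuous).mul (f.continuous_schrodingerExpr d q μ)
  have i1 := integrableOn_halfLine_of_off f.hasCompactSupport f.tsupport_subset c1.continuousOn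
    (fun s hs => by simp [f.eq_zero_off hs])
  have i2 := integrableOn_halfLine_of_off f.hasCompactSupport f.tsupport_subset c2.continuousOn
    (fun s hs => by simp [f.eq_zero_off hs])
  -- the total derivative of `|f|² / (2s) - Re (conj f * f')`
  set k : ℝ → ℝ := fun s => (1 / (2 * s)) * (conj (f s) * f s).re - (conj (f s) * deriv f s).re
  set k' : ℝ → ℝ := fun s =>
    (-1 / (2 * s ^ 2)) * (conj (f s) * f s).re
      + (1 / (2 * s)) * (conj (deriv f s) * f s + conj (f s) * deriv f s).re
      - (conj (deriv f s) * deriv f s + conj (f s) * deriv (deriv f) s).re with hk'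
  have ck' : ContinuousOn k' (Ioi 0) := by
    have a1 : Continuous (deriv f) := f.contDiff_deriv.continuous
    have a2 := f.continuous_deriv_two
    have a3 := f.continuous
    have b1 : ContinuousOn (fun s : ℝ => -1 / (2 * s ^ 2)) (Ioi 0) :=
      continuousOn_const.div (by fun_prop) fun s (hs : 0 < s) => by positivity
    have b2 : ContinuousOn (fun s : ℝ => 1 / (2 * s)) (Ioi 0) :=
      continuousOn_const.div (by fun_prop) fun s (hs : 0 < s) => by positivity
    refine ((b1.mul (Continuous.continuousOn ?_)).add
      (b2.mul (Continuous.continuousOn ?_))).sub (Continuous.continuousOn ?_) <;> fun_prop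
  have k'0 : ∀ s, s ∉ tsupport f → k' s = 0 := fun s hs => by
    simp [hk', f.eq_zero_off hs, f.deriv_eq_zero_off hs]
  have ik' := integrableOn_halfLine_of_off f.hasCompactSupport f.tsupport_subset ck' k'0
  have zk' : ∫ s in Ioi (0 : ℝ), k' s = 0 := by
    refine integral_halfLine_deriv_eq_zero (h := k) f.hasCompactSupport f.tsupport_subset
      ?_ ck' (fun s hs => by simp [k, f.eq_zero_off hs]) k'0
    intro s hs
    have d0 : HasDerivAt (fun s : ℝ => 1 / (2 * s)) (-1 / (2 * s ^ 2)) s := by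
      have := ((hasDerivAt_id s).const_mul 2).inv (by simpa using hs.ne')
      simp only [one_div]
      refine this.congr_deriv ?_
      simp only [id]
      field_simp
    have d1 := Complex.reCLM.hasFDerivAt.comp_hasDerivAt s
      ((f.hasDerivAt_one s).star.mul (f.hasDerivAt_one s))
    have d2 := Complex.reCLM.hasFDerivAt.comp_hasDerivAt s
      ((f.hasDerivAt_one s).star.mul (f.hasDerivAt_two s))
    exact ((d0.mul d1).sub d2)
  have r1 : RCLike.re (∫ s in Ioi (0 : ℝ), conj (f s) * f s) =
      ∫ s in Ioi (0 : ℝ), (conj (f s) * f s).re := (integral_re i1).symm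
  have r2 : RCLike.re (∫ s in Ioi (0 : ℝ),
        conj (f s) * schrodingerExpr (peakPotential d q μ) f s) =
      ∫ s in Ioi (0 : ℝ), (conj (f s) * schrodingerExpr (peakPotential d q μ) f s).re :=
    (integral_re i2).symm
  rw [r1, r2, ← integral_const_mul]
  have j1 : IntegrableOn (fun s => -C * (conj (f s) * f s).re) (Ioi 0) := (i1.re).const_mul _
  have j2 : IntegrableOn
      (fun s => (conj (f s) * schrodingerExpr (peakPotential d q μ) f s).re) (Ioi 0) := i2.re
  calc ∫ s in Ioi (0 : ℝ), -C * (conj (f s) * f s).re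
      = ∫ s in Ioi (0 : ℝ), (-C * (conj (f s) * f s).re + k' s) := by
        rw [integral_add j1 ik', zk', add_zero]
    _ ≤ _ := by
        refine setIntegral_mono_on (j1.add ik') j2 measurableSet_Ioi fun s (hs : 0 < s) => ?_
        have hV := hC s hs
        have hf0 : 0 ≤ (f s).re ^ 2 + (f s).im ^ 2 := by positivity
        have hm := mul_le_mul_of_nonneg_right hV hf0
        have hsq1 := sq_nonneg ((deriv f s).re - (1 / (2 * s)) * (f s).re)
        have hsq2 := sq_nonneg ((deriv f s).im - (1 / (2 * s)) * (f s).im)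
        have e1 : -1 / (4 * s ^ 2) = -(1 / (2 * s)) ^ 2 := by (field_simp; norm_num)
        have e2 : -1 / (2 * s ^ 2) = -2 * (1 / (2 * s)) ^ 2 := by field_simp
        rw [e1] at hm
        simp only [hk', schrodingerExpr, e2]
        simp only [Complex.add_re, Complex.mul_re, Complex.conj_re, Complex.conj_im,
          Complex.neg_re, Complex.neg_im, Complex.ofReal_re, Complex.ofReal_im, Complex.add_im,
          Complex.mul_im]
        nlinarith

theorem minimalOp_isSemibounded {d : ℕ} (hd : 2 ≤ d) {q : ℝ} (hq1 : 1 < q) (hq2 : q < 2)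
    {μ : ℝ} (hμ : 0 < μ) : (minimalOp d q μ).IsSemibounded :=
  ⟨minimalOp_dense d q μ, minimalOp_symm d q μ, minimalOp_lower_bound hd hq1 hq2 hμ⟩

/-- The operator `L_μ` in `L²(0, ∞)`: the Friedrichs extension of
`C_c^∞(0, ∞) ∋ f ↦ -f'' + ((q²(d-1)² - 2q(d-1)) / (4s²) - μ / s^q) f`. -/
def peakOp {d : ℕ} (hd : 2 ≤ d) {q : ℝ} (hq1 : 1 < q) (hq2 : q < 2) {μ : ℝ} (hμ : 0 < μ) :
    HalfLineL2 →ₗ.[ℂ] HalfLineL2 :=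
  (minimalOp d q μ).friedrichsExtension (minimalOp_isSemibounded hd hq1 hq2 hμ)

end SchrodingerOperator

end

open MeasureTheory Set Filter Topology TopologicalSpace
open scoped Distributions ComplexConjugate

noncomputable section

/-! ### Finding one eigenvalue of a bounded self-adjoint operator by counting dimensions. -/

section BoundedOperators

variable {Q : Type*} [NormedAddCommGroup Q] [InnerProductSpace ℂ Q]

/-! Put `p = q (d - 1) > 1`. Since `p² - 2p = (p - 1)² - 1`, the potential is the critical Hardy
weight `-1/(4s²)`, plus a strictly positive multiple of `1/s²`, minus `μ/s^q`. As `q < 2`, the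
`1/s²` terms win near the origin and the attraction `-μ/s^q` wins at infinity, where the potential
nevertheless tends to zero.

Two facts follow. First, the form is at least `-ε` up to a finite-rank term for every `ε > 0`, which
amounts to having no essential spectrum below zero (`exists_minimalOp_quadForm_lower_bound`):
outside a bounded interval the potential exceeds `-ε`, and inside it a Poincaré inequality on short
subintervals absorbs the remaining bounded well into the spare kinetic energy. Second, the form is
negative on spaces of any finite dimension (`exists_orthogonal_quadForm_minimalOp_neg`): spreading a
bump out by a large factor makes its energy negative, and widely separated scales give disjoint
supports.

The abstract part turns this into eigenvalues in `[-ε, 0)` for every `ε`, hence infinitely many. On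
the completion `Q` of the operator domain in the form norm `⟪x, T x⟫ + M ‖x‖²`, the map `J` into `H`
gives a bounded self-adjoint operator `R = J* J`. An eigenvalue `l > 0` of `R` corresponds to the
eigenvalue `l⁻¹ - M` of the Friedrichs extension. The relevant part of `R` lies above a threshold
strictly larger than `1/M`, where the first fact makes it finite-dimensional, so the matter reduces
to linear algebra (`IsSelfAdjoint.exists_eigenvector_mem_Ioc`). -/

theorem ContinuousLinearMap.re_inner_eq_norm_sqrt_sq [CompleteSpace Q] {K : Q →L[ℂ] Q}
    (hK : 0 ≤ K) (x : Q) : (inner ℂ x (K x)).re = ‖CFC.sqrt K x‖ ^ 2 := by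
  have hS : IsSelfAdjoint (CFC.sqrt K) := IsSelfAdjoint.of_nonneg (CFC.sqrt_nonneg K)
  have hsym : inner ℂ (CFC.sqrt K x) (CFC.sqrt K x) = inner ℂ x (CFC.sqrt K (CFC.sqrt K x)) :=
    hS.isSymmetric x _
  conv_lhs => rw [← CFC.sqrt_mul_sqrt_self K hK]
  rw [mul_apply_eq_comp, ← hsym]
  exact (norm_sq_eq_re_inner (𝕜 := ℂ) _).symm

theorem ContinuousLinearMap.apply_eq_zero_of_re_inner_eq_zero [CompleteSpace Q] {K : Q →L[ℂ] Q}
    (hK : 0 ≤ K) {x : Q} (h : (inner ℂ x (K x)).re = 0) : K x = 0 := by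
  rw [K.re_inner_eq_norm_sqrt_sq hK, sq_eq_zero_iff, norm_eq_zero] at h
  conv_lhs => rw [← CFC.sqrt_mul_sqrt_self K hK]
  rw [mul_apply_eq_comp, h, map_zero]

/-- A symmetric operator on a nontrivial finite-dimensional space has an eigenvalue below each
value of its Rayleigh quotient. -/
theorem LinearMap.IsSymmetric.exists_eigenvector_le {Y : Type*} [NormedAddCommGroup Y]
    [InnerProductSpace ℂ Y] [FiniteDimensional ℂ Y] {S : Y →ₗ[ℂ] Y} (hS : S.IsSymmetric)
    {θ : ℝ} {y : Y} (hy : y ≠ 0) (h : (inner ℂ y (S y)).re ≤ θ * ‖y‖ ^ 2) :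
    ∃ l : ℝ, l ≤ θ ∧ ∃ v : Y, v ≠ 0 ∧ S v = (l : ℂ) • v := by
  have : Nontrivial Y := ⟨y, 0, hy⟩
  obtain ⟨v, hv⟩ := hS.hasEigenvalue_iInf_of_finiteDimensional.exists_hasEigenvector
  refine ⟨_, ?_, v, hv.2, hv.apply_eq_smul⟩
  have hbdd : BddBelow (Set.range fun x : {x : Y // x ≠ 0} =>
      RCLike.re (inner ℂ (S (x : Y)) (x : Y)) / ‖(x : Y)‖ ^ 2) := by
    refine ⟨-‖S.toContinuousLinearMap‖, ?_⟩
    rintro _ ⟨x, rfl⟩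
    have hx : 0 < ‖(x : Y)‖ := norm_pos_iff.2 x.2
    have h1 : ‖inner ℂ (S (x : Y)) (x : Y)‖ ≤ ‖S.toContinuousLinearMap‖ * ‖(x : Y)‖ ^ 2 := by
      refine (norm_inner_le_norm _ _).trans ?_
      rw [pow_two, ← mul_assoc]
      gcongr
      exact S.toContinuousLinearMap.le_opNorm x
    have h2 := (abs_le.1 (RCLike.abs_re_le_norm (inner ℂ (S (x : Y)) (x : Y)))).1
    change _ ≤ _ / _
    rw [le_div_iff₀ (by positivity)]
    linarith
  refine (ciInf_le hbdd ⟨y, hy⟩).trans ?_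
  have hx : 0 < ‖y‖ := norm_pos_iff.2 hy
  change RCLike.re (inner ℂ (S y) y) / ‖y‖ ^ 2 ≤ θ
  rw [div_le_iff₀ (by positivity), hS y y]
  exact h

/-- If a bounded self-adjoint operator is at most `θ₁` on a subspace of finite codimension, at most
`θ₂` on a subspace of codimension `k`, and larger than `θ₁` on a subspace of dimension larger than
`k`, then it has an eigenvalue in `(θ₁, θ₂]`. -/
theorem IsSelfAdjoint.exists_eigenvector_mem_Ioc [CompleteSpace Q] {R : Q →L[ℂ] Q}
    (hR : IsSelfAdjoint R) {θ₁ θ₂ : ℝ}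
    {F₁ F₂ : Type*} [AddCommGroup F₁] [Module ℂ F₁] [FiniteDimensional ℂ F₁]
    [AddCommGroup F₂] [Module ℂ F₂] [FiniteDimensional ℂ F₂]
    (Φ₁ : Q →ₗ[ℂ] F₁) (h₁ : ∀ x, Φ₁ x = 0 → (inner ℂ x (R x)).re ≤ θ₁ * ‖x‖ ^ 2)
    (Φ₂ : Q →ₗ[ℂ] F₂) (h₂ : ∀ x, Φ₂ x = 0 → (inner ℂ x (R x)).re ≤ θ₂ * ‖x‖ ^ 2)
    (X : Submodule ℂ Q) (hX : Module.finrank ℂ F₂ < Module.finrank ℂ X)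
    (hXR : ∀ x ∈ X, x ≠ 0 → θ₁ * ‖x‖ ^ 2 < (inner ℂ x (R x)).re) :
    ∃ l : ℝ, θ₁ < l ∧ l ≤ θ₂ ∧ ∃ v : Q, v ≠ 0 ∧ R v = (l : ℂ) • v := by
  set A : Q →L[ℂ] Q := R - (θ₁ : ℂ) • 1 with hA
  have hAapp : ∀ x, A x = R x - (θ₁ : ℂ) • x := fun x => by simp [hA]
  have hAsa : IsSelfAdjoint A :=
    hR.sub (IsSelfAdjoint.smul (Complex.conj_ofReal θ₁) (IsSelfAdjoint.one _))
  have hAre : ∀ x, (inner ℂ x (A x)).re = (inner ℂ x (R x)).re - θ₁ * ‖x‖ ^ 2 := fun x => by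
    have h : ‖x‖ ^ 2 = (inner ℂ x x).re := norm_sq_eq_re_inner (𝕜 := ℂ) x
    rw [hAapp, inner_sub_right, inner_smul_right, Complex.sub_re, Complex.re_ofReal_mul, h]
  have hdec : A⁺ - A⁻ = A := CFC.posPart_sub_negPart A hAsa
  have hK0 : 0 ≤ A⁺ := CFC.posPart_nonneg A
  have hKm0 : 0 ≤ A⁻ := CFC.negPart_nonneg A
  have hKsa : IsSelfAdjoint A⁺ := IsSelfAdjoint.of_nonneg hK0
  have hAK : A * A⁺ = A⁺ * A⁺ := by
    have : A * A⁺ = (A⁺ - A⁻) * A⁺ := by rw [hdec]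
    rw [this, sub_mul, CFC.negPart_mul_posPart, sub_zero]
  have hAle : ∀ x, (inner ℂ x (A x)).re ≤ (inner ℂ x (A⁺ x)).re := fun x => by
    have h := ((ContinuousLinearMap.nonneg_iff_isPositive _).1 hKm0).re_inner_nonneg_right x
    have e : A x = A⁺ x - A⁻ x := by
      conv_lhs => rw [← hdec]
      rfl
    rw [e, inner_sub_right, Complex.sub_re]
    exact sub_le_self _ h
  -- The range of `A⁺` plays the role of the spectral subspace of `R` for `(θ₁, ∞)`. It is invariant
  -- because `A A⁺ = A⁺ A⁺`. The form of `A` is strictly positive on it, so `Φ₁` is injective there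
  -- and the space is finite-dimensional.
  set Y : Submodule ℂ Q := LinearMap.range (A⁺ : Q →L[ℂ] Q).toLinearMap with hY
  have hYA : ∀ y ∈ Y, A y = A⁺ y := by
    rintro _ ⟨g, rfl⟩
    exact congrArg (fun B : Q →L[ℂ] Q => B g) hAK
  have hYpos : ∀ y ∈ Y, y ≠ 0 → θ₁ * ‖y‖ ^ 2 < (inner ℂ y (R y)).re := by
    intro y hy hy0
    have h0 : 0 ≤ (inner ℂ y (A⁺ y)).re :=
      ((ContinuousLinearMap.nonneg_iff_isPositive _).1 hK0).re_inner_nonneg_right y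
    have h1 := hAre y
    rw [hYA y hy] at h1
    have h2 : (inner ℂ y (A⁺ y)).re ≠ 0 := fun h => by
      have h3 := ContinuousLinearMap.apply_eq_zero_of_re_inner_eq_zero hK0 h
      obtain ⟨g, rfl⟩ := hy
      apply hy0
      have h4 : inner ℂ (A⁺ g) (A⁺ g) = inner ℂ g (A⁺ (A⁺ g)) := hKsa.isSymmetric g _
      change A⁺ (A⁺ g) = 0 at h3
      rw [h3, inner_zero_right, inner_self_eq_zero] at h4
      exact h4
    have h3 := lt_of_le_of_ne h0 (Ne.symm h2)
    linarith
  have hYfin : FiniteDimensional ℂ Y := by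
    refine FiniteDimensional.of_injective (Φ₁ ∘ₗ Y.subtype) ?_
    rw [← LinearMap.ker_eq_bot, LinearMap.ker_eq_bot']
    intro y hy
    by_contra hne
    have := hYpos y y.2 (by simpa using hne)
    exact absurd (h₁ y hy) (not_le.2 this)
  -- `A⁺` is injective on `X`, since `⟪x, A⁺ x⟫ ≥ ⟪x, A x⟫ > 0` for nonzero `x ∈ X`.
  have hXY : Module.finrank ℂ X ≤ Module.finrank ℂ Y := by
    refine LinearMap.finrank_le_finrank_of_injective
      (f := ((A⁺ : Q →L[ℂ] Q).toLinearMap.rangeRestrict ∘ₗ X.subtype)) ?_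
    rw [← LinearMap.ker_eq_bot, LinearMap.ker_eq_bot']
    intro x hx
    by_contra hne
    have hx' : A⁺ (x : Q) = 0 := congrArg Subtype.val hx
    have h1 := hAle x
    rw [hx', inner_zero_right, hAre] at h1
    have h2 := hXR x x.2 (by simpa using hne)
    simp only [Complex.zero_re] at h1
    linarith
  -- As `dim Y ≥ dim X > dim F₂`, the map `Φ₂` has a kernel in `Y`. A vector there has Rayleigh
  -- quotient at most `θ₂`, which bounds the lowest eigenvalue of `R` on `Y`.
  obtain ⟨y, hy, hy0⟩ : ∃ y : Y, Φ₂ y = 0 ∧ y ≠ 0 := by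
    by_contra! hcon
    have hinj : Function.Injective (Φ₂ ∘ₗ Y.subtype) := by
      rw [← LinearMap.ker_eq_bot, LinearMap.ker_eq_bot']
      exact fun y hy => hcon y hy
    have := LinearMap.finrank_le_finrank_of_injective hinj
    omega
  have hYR : ∀ z ∈ Y, R.toLinearMap z ∈ Y := by
    intro z hz
    have h1 : R z = A⁺ z + (θ₁ : ℂ) • z := by
      rw [← hYA z hz, hAapp, sub_add_cancel]
    change R z ∈ Y
    rw [h1]
    exact Y.add_mem ⟨z, rfl⟩ (Y.smul_mem _ hz)
  have hsymm : (R.toLinearMap.restrict hYR).IsSymmetric :=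
    LinearMap.IsSymmetric.restrict_invariant hR.isSymmetric hYR
  obtain ⟨l, hl, v, hv0, hv⟩ := hsymm.exists_eigenvector_le hy0 (θ := θ₂) (h₂ y hy)
  have hv' : R (v : Q) = (l : ℂ) • (v : Q) := congrArg Subtype.val hv
  have hvQ : (v : Q) ≠ 0 := by simpa using hv0
  refine ⟨l, ?_, hl, v, hvQ, hv'⟩
  have h1 := hYpos v v.2 hvQ
  rw [hv', inner_smul_right, inner_self_eq_norm_sq_to_K] at h1
  have h2 : ((l : ℂ) * ((‖(v : Q)‖ : ℝ) : ℂ) ^ 2).re = l * ‖(v : Q)‖ ^ 2 := by norm_cast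
  have h3 : θ₁ * ‖(v : Q)‖ ^ 2 < l * ‖(v : Q)‖ ^ 2 := by
    rw [← h2]; exact h1
  exact lt_of_mul_lt_mul_right h3 (by positivity)

end BoundedOperators

/-! ### Passing to the completion in the form norm. -/

section FormEmbedding

variable {D H : Type*} [SeminormedAddCommGroup D] [InnerProductSpace ℂ D]
  [NormedAddCommGroup H] [InnerProductSpace ℂ H] [CompleteSpace H]

/-- The generalized eigenvalue problem `⟪j v, j u⟫ = l ⟪v, u⟫` on the completion of a
pre-Hilbert space `D` which is continuously mapped to a Hilbert space. -/
theorem exists_form_eigenvector (j : D →L[ℂ] H) {θ₁ θ₂ : ℝ} (hθ₁ : 0 ≤ θ₁)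
    {F₁ F₂ : Type*} [NormedAddCommGroup F₁] [NormedSpace ℂ F₁] [FiniteDimensional ℂ F₁]
    [NormedAddCommGroup F₂] [NormedSpace ℂ F₂] [FiniteDimensional ℂ F₂]
    (Φ₁ : H →L[ℂ] F₁) {C₁ : ℝ}
    (h₁ : ∀ x, ‖j x‖ ^ 2 ≤ θ₁ * ‖x‖ ^ 2 + C₁ * ‖Φ₁ (j x)‖ ^ 2)
    (Φ₂ : H →L[ℂ] F₂) {C₂ : ℝ}
    (h₂ : ∀ x, ‖j x‖ ^ 2 ≤ θ₂ * ‖x‖ ^ 2 + C₂ * ‖Φ₂ (j x)‖ ^ 2)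
    (X : Submodule ℂ D) (hX : Module.finrank ℂ F₂ < Module.finrank ℂ X)
    (hXj : ∀ x ∈ X, x ≠ 0 → θ₁ * ‖x‖ ^ 2 < ‖j x‖ ^ 2) :
    ∃ l : ℝ, θ₁ < l ∧ l ≤ θ₂ ∧ ∃ (u : ℕ → D) (w : H), w ≠ 0 ∧ CauchySeq u ∧
      Tendsto (fun n => j (u n)) atTop (𝓝 w) ∧
      ∀ v, Tendsto (fun n => (l : ℂ) * inner ℂ v (u n)) atTop (𝓝 (inner ℂ (j v) w)) := by
  let Q := UniformSpace.Completion D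
  let ι : D →L[ℂ] Q := UniformSpace.Completion.toComplL
  have hιd : DenseRange ι := UniformSpace.Completion.denseRange_coe
  have hιu : IsUniformInducing ι := UniformSpace.Completion.isUniformInducing_coe D
  let J : Q →L[ℂ] H := j.extend ι
  have hJ : ∀ x, J (ι x) = j x := fun x => j.extend_eq hιd hιu x
  have hιn : ∀ x, ‖ι x‖ = ‖x‖ := fun x => UniformSpace.Completion.norm_coe x
  have hιi : ∀ x y, inner ℂ (ι x) (ι y) = inner ℂ x y :=
    fun x y => UniformSpace.Completion.inner_coe x y
  let R : Q →L[ℂ] Q := J.adjoint ∘L J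
  have hR : IsSelfAdjoint R := by
    rw [ContinuousLinearMap.isSelfAdjoint_iff_isSymmetric]
    intro x y
    change inner ℂ (J.adjoint (J x)) y = inner ℂ x (J.adjoint (J y))
    rw [ContinuousLinearMap.adjoint_inner_left, ContinuousLinearMap.adjoint_inner_right]
  have hRre : ∀ x, (inner ℂ x (R x)).re = ‖J x‖ ^ 2 := fun x => by
    change (inner ℂ x (J.adjoint (J x))).re = _
    rw [ContinuousLinearMap.adjoint_inner_right]
    exact (norm_sq_eq_re_inner (𝕜 := ℂ) _).symm
  -- A bound with a penalty term, unlike one assumed only on the kernel of `Φ₁` or `Φ₂`, is a closed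
  -- condition and so extends from the dense subspace to its completion.
  have ext : ∀ {N : H → ℝ} {θ C : ℝ}, Continuous N →
      (∀ x, ‖j x‖ ^ 2 ≤ θ * ‖x‖ ^ 2 + C * N (j x)) →
      ∀ x : Q, ‖J x‖ ^ 2 ≤ θ * ‖x‖ ^ 2 + C * N (J x) := by
    intro N θ C hN h x
    refine hιd.induction_on (p := fun x : Q => ‖J x‖ ^ 2 ≤ θ * ‖x‖ ^ 2 + C * N (J x)) x
      (isClosed_le (by fun_prop) (by fun_prop)) fun y => ?_
    rw [hJ, hιn]
    exact h y
  have hιX : Function.Injective (ι.toLinearMap ∘ₗ X.subtype) := by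
    rw [← LinearMap.ker_eq_bot, LinearMap.ker_eq_bot']
    intro x hx
    by_contra hne
    have h0 : ι (x : D) = 0 := hx
    have h1 := hXj x x.2 (by simpa using hne)
    rw [← hJ, ← hιn, h0] at h1
    simp at h1
  obtain ⟨l, hl1, hl2, v, hv0, hv⟩ := hR.exists_eigenvector_mem_Ioc (θ₁ := θ₁) (θ₂ := θ₂)
    (Φ₁ ∘L J).toLinearMap (fun x hx => by
      have hx' : Φ₁ (J x) = 0 := hx
      have := ext (N := fun z => ‖Φ₁ z‖ ^ 2) (by fun_prop) h₁ x
      simp only [hx'] at this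
      rw [hRre]
      simpa using this)
    (Φ₂ ∘L J).toLinearMap (fun x hx => by
      have hx' : Φ₂ (J x) = 0 := hx
      have := ext (N := fun z => ‖Φ₂ z‖ ^ 2) (by fun_prop) h₂ x
      simp only [hx'] at this
      rw [hRre]
      simpa using this)
    (LinearMap.range (ι.toLinearMap ∘ₗ X.subtype))
    (by rwa [LinearMap.finrank_range_of_inj hιX])
    (by
      rintro _ ⟨x, rfl⟩ hne
      have hx0 : (x : D) ≠ 0 := fun h => hne (by simp [h])
      have := hXj x x.2 hx0
      rw [hRre]
      change θ₁ * ‖ι (x : D)‖ ^ 2 < ‖J (ι (x : D))‖ ^ 2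
      rwa [hJ, hιn])
  have hl0 : l ≠ 0 := (hθ₁.trans_lt hl1).ne'
  obtain ⟨u, hu⟩ : ∃ u : ℕ → D, Tendsto (fun n => ι (u n)) atTop (𝓝 v) := by
    obtain ⟨y, hy, hyv⟩ := mem_closure_iff_seq_limit.1 (hιd v)
    choose u hu using hy
    exact ⟨u, by simpa only [hu] using hyv⟩
  refine ⟨l, hl1, hl2, u, J v, ?_, ?_, ?_, ?_⟩
  -- Injectivity of `J` is not needed: `J v = 0` would give `l v = R v = 0`, while `l > θ₁ ≥ 0` and
  -- `v ≠ 0`.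
  · intro h
    have h1 : R v = 0 := by
      change J.adjoint (J v) = 0
      rw [h, map_zero]
    rw [h1] at hv
    rcases smul_eq_zero.1 hv.symm with h2 | h2
    · exact hl0 (by exact_mod_cast h2)
    · exact hv0 h2
  · exact hιu.cauchy_map_iff.1 (by rw [Filter.map_map]; exact hu.cauchySeq)
  · have := (J.continuous.tendsto v).comp hu
    simpa only [Function.comp_def, hJ] using this
  · intro y
    have h1 : inner ℂ (j y) (J v) = (l : ℂ) * inner ℂ (ι y) v := by
      rw [← hJ, ← ContinuousLinearMap.adjoint_inner_right]
      change inner ℂ (ι y) (R v) = _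
      rw [hv, inner_smul_right]
    rw [h1]
    have h2 := ((continuous_const.inner continuous_id).tendsto v).comp hu (f := fun n => ι (u n))
      (g := fun z : Q => inner ℂ (ι y) z)
    simp only [Function.comp_def, hιi] at h2
    exact h2.const_mul _

end FormEmbedding

/-! ### Negative eigenvalues of a Friedrichs extension from form bounds. -/

section FriedrichsEigenvalues

variable {H : Type*} [NormedAddCommGroup H] [InnerProductSpace ℂ H]

theorem LinearPMap.quadForm_sum {ι : Type*} [Fintype ι] (T : H →ₗ.[ℂ] H) (f : ι → T.domain)
    (hT : Pairwise fun i k => inner ℂ (f i : H) (T (f k)) = 0) (c : ι → ℂ) :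
    T.quadForm (∑ i, c i • f i) = ∑ i, ‖c i‖ ^ 2 * T.quadForm (f i) := by
  have h1 : T (∑ i, c i • f i) = ∑ i, c i • T (f i) := by
    change T.toFun _ = ∑ i, c i • T.toFun (f i)
    simp
  unfold LinearPMap.quadForm
  rw [h1]
  simp only [AddSubmonoidClass.coe_finsetSum, Submodule.coe_smul, sum_inner, inner_sum,
    inner_smul_left, inner_smul_right]
  rw [map_sum]
  refine Finset.sum_congr rfl fun i _ => ?_
  rw [Finset.sum_eq_single i (fun k _ hk => by rw [hT hk]; simp) (by simp), ← mul_assoc,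
    mul_comm (c i), ← Complex.normSq_eq_conj_mul_self, Complex.normSq_eq_norm_sq]
  exact Complex.re_ofReal_mul _ _

theorem norm_sq_sum_of_orthogonal {ι : Type*} [Fintype ι] (f : ι → H)
    (hf : Pairwise fun i k => inner ℂ (f i) (f k) = 0) (c : ι → ℂ) :
    ‖∑ i, c i • f i‖ ^ 2 = ∑ i, ‖c i‖ ^ 2 * ‖f i‖ ^ 2 := by
  -- The squared norm is the quadratic form of the identity.
  set S : H →ₗ.[ℂ] H := LinearMap.toPMap LinearMap.id ⊤
  have hS : ∀ x : S.domain, S x = x := fun _ => rfl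
  have h := S.quadForm_sum (fun i => ⟨f i, trivial⟩) (fun i k hik => hf hik) c
  simp only [LinearPMap.quadForm, hS, AddSubmonoidClass.coe_finsetSum, Submodule.coe_smul] at h
  simpa only [← norm_sq_eq_re_inner] using h

/-- The domain of `T`, to be equipped with the form inner product `⟪x, T y⟫ + M ⟪x, y⟫`. -/
def LinearPMap.FormSpace (T : H →ₗ.[ℂ] H) : Type _ := T.domain

instance (T : H →ₗ.[ℂ] H) : AddCommGroup T.FormSpace := inferInstanceAs (AddCommGroup T.domain)

instance (T : H →ₗ.[ℂ] H) : Module ℂ T.FormSpace := inferInstanceAs (Module ℂ T.domain)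

/-- The inclusion of the form space in the ambient space. -/
def LinearPMap.FormSpace.incl (T : H →ₗ.[ℂ] H) : T.FormSpace →ₗ[ℂ] H := T.domain.subtype

/-- The operator as a linear map on the form space. -/
def LinearPMap.FormSpace.op (T : H →ₗ.[ℂ] H) : T.FormSpace →ₗ[ℂ] H := T.toFun

/-- The form inner product `⟪x, T y⟫ + M ⟪x, y⟫`. -/
abbrev LinearPMap.FormSpace.core (T : H →ₗ.[ℂ] H) (hs : T.IsFormalAdjoint T) (M : ℝ)
    (hM : ∀ x : T.domain, ‖(x : H)‖ ^ 2 ≤ T.quadForm x + M * ‖(x : H)‖ ^ 2) :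
    PreInnerProductSpace.Core ℂ T.FormSpace where
  inner x y := inner ℂ (incl T x) (op T y) + M * inner ℂ (incl T x) (incl T y)
  conj_inner_symm x y := by
    simp only [_root_.map_add, map_mul, Complex.conj_ofReal, inner_conj_symm]
    congr 1
    exact hs x y
  re_inner_nonneg x := by
    refine le_trans (sq_nonneg ‖incl T x‖) ((hM x).trans_eq ?_)
    have h : ‖incl T x‖ ^ 2 = (inner ℂ (incl T x) (incl T x)).re :=
      norm_sq_eq_re_inner (𝕜 := ℂ) (incl T x)
    change _ = (inner ℂ (incl T x) (op T x) + M * inner ℂ (incl T x) (incl T x)).re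
    rw [Complex.add_re, Complex.re_ofReal_mul, ← h]
    rfl
  add_left x y z := by
    simp only [_root_.map_add, inner_add_left]
    ring
  smul_left x y r := by
    simp only [_root_.map_smul, inner_smul_left]
    ring

/-- If the quadratic form of a semibounded operator is nonnegative up to arbitrarily small
constants and finite-rank perturbations, and if it is negative on spaces of arbitrarily large
dimension, then its Friedrichs extension has negative eigenvalues arbitrarily close to zero. -/
theorem LinearPMap.IsSemibounded.exists_eigenvalue_mem_Ico [CompleteSpace H] {T : H →ₗ.[ℂ] H}
    (hT : T.IsSemibounded)
    (hess : ∀ ε : ℝ, 0 < ε → ∃ (k : ℕ) (Φ : H →L[ℂ] EuclideanSpace ℂ (Fin k)) (C : ℝ),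
      ∀ x : T.domain, -ε * ‖(x : H)‖ ^ 2 - C * ‖Φ x‖ ^ 2 ≤ T.quadForm x)
    (hneg : ∀ n : ℕ, ∃ f : Fin n → T.domain,
      (Pairwise fun i k => inner ℂ (f i : H) (f k : H) = 0) ∧
      (Pairwise fun i k => inner ℂ (f i : H) (T (f k)) = 0) ∧ ∀ i, T.quadForm (f i) < 0)
    {ε : ℝ} (hε : 0 < ε) :
    ∃ E : ℝ, -ε ≤ E ∧ E < 0 ∧ (T.friedrichsExtension hT).HasEigenvalue (E : ℂ) := by
  obtain ⟨c, hc⟩ := hT.lower_bound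
  -- With this shift the form norm dominates the norm of `H`, so the inclusion `j` is a contraction.
  set M : ℝ := |c| + 1 with hMdef
  have hM1 : 1 ≤ M := by simp [hMdef]
  have hM : ∀ x : T.domain, ‖(x : H)‖ ^ 2 ≤ T.quadForm x + M * ‖(x : H)‖ ^ 2 := fun x => by
    have h1 : c * ‖(x : H)‖ ^ 2 ≤ T.quadForm x := hc x
    have h2 := mul_le_mul_of_nonneg_right (neg_abs_le c) (sq_nonneg ‖(x : H)‖)
    rw [hMdef]
    linarith
  let core := LinearPMap.FormSpace.core T hT.symm M hM
  let _ : SeminormedAddCommGroup T.FormSpace :=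
    InnerProductSpace.Core.toSeminormedAddCommGroup (𝕜 := ℂ) (F := T.FormSpace)
  let _ : InnerProductSpace ℂ T.FormSpace := InnerProductSpace.ofCore core
  have hin : ∀ x y : T.FormSpace, inner ℂ x y =
      inner ℂ ((show T.domain from x) : H) (T y) + M * inner ℂ ((show T.domain from x) : H)
        ((show T.domain from y) : H) := fun x y => rfl
  have hnorm : ∀ x : T.FormSpace, ‖x‖ ^ 2 =
      T.quadForm x + M * ‖((show T.domain from x) : H)‖ ^ 2 := fun x => by
    have h : ‖((show T.domain from x) : H)‖ ^ 2 = (inner ℂ ((show T.domain from x) : H)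
      ((show T.domain from x) : H)).re := norm_sq_eq_re_inner (𝕜 := ℂ) _
    rw [norm_sq_eq_re_inner (𝕜 := ℂ) x, hin, h]
    change (_ + _ : ℂ).re = _
    rw [Complex.add_re, Complex.re_ofReal_mul]
    rfl
  let j : T.FormSpace →L[ℂ] H := (LinearPMap.FormSpace.incl T).mkContinuous 1 fun x => by
    rw [one_mul, ← sq_le_sq₀ (norm_nonneg _) (norm_nonneg _), hnorm]
    exact hM x
  have bound : ∀ {η : ℝ} {k : ℕ} {Φ : H →L[ℂ] EuclideanSpace ℂ (Fin k)} {C : ℝ}, η < M →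
      (∀ x : T.domain, -η * ‖(x : H)‖ ^ 2 - C * ‖Φ x‖ ^ 2 ≤ T.quadForm x) →
      ∀ x, ‖j x‖ ^ 2 ≤ (M - η)⁻¹ * ‖x‖ ^ 2 + ((M - η)⁻¹ * C) * ‖Φ (j x)‖ ^ 2 := by
    intro η k Φ C hη h x
    rw [mul_assoc, ← mul_add, inv_mul_eq_div, le_div_iff₀ (by linarith), hnorm]
    have := h x
    change ‖j x‖ ^ 2 * (M - η) ≤ T.quadForm x + M * ‖j x‖ ^ 2 + C * ‖Φ (j x)‖ ^ 2
    change -η * ‖j x‖ ^ 2 - C * ‖Φ (j x)‖ ^ 2 ≤ T.quadForm x at this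
    linarith
  -- The cap `1 / 2` keeps `ε'` below `M ≥ 1`, so that `(M - ε')⁻¹` is positive.
  set ε' : ℝ := min ε (1 / 2) with hε'
  have hε'0 : 0 < ε' := by positivity
  have hε'M : ε' < M := by
    have : ε' ≤ 1 / 2 := min_le_right _ _
    linarith
  obtain ⟨k₂, Φ₂, C₂, h₂⟩ := hess ε' hε'0
  -- The order of choices matters: `ε'` fixes the rank `k₂`, which fixes the number of negative
  -- directions. These fix how small `η` must be, and only then is `Φ₁` chosen, whose rank is
  -- irrelevant.
  obtain ⟨f, hf1, hf2, hf3⟩ := hneg (k₂ + 1)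
  obtain ⟨η, hη, hη0, hηε⟩ : ∃ η : ℝ, (∀ i, T.quadForm (f i) + η * ‖(f i : H)‖ ^ 2 < 0) ∧
      0 < η ∧ η < ε' := by
    have h1 : ∀ᶠ η : ℝ in 𝓝[>] 0, ∀ i, T.quadForm (f i) + η * ‖(f i : H)‖ ^ 2 < 0 := by
      rw [eventually_all]
      intro i
      have : Tendsto (fun η : ℝ => T.quadForm (f i) + η * ‖(f i : H)‖ ^ 2) (𝓝 0)
          (𝓝 (T.quadForm (f i) + 0 * ‖(f i : H)‖ ^ 2)) :=
        (by fun_prop : Continuous fun η : ℝ => T.quadForm (f i) + η * ‖(f i : H)‖ ^ 2).tendsto 0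
      rw [zero_mul, add_zero] at this
      exact (this.mono_left nhdsWithin_le_nhds).eventually_lt_const (hf3 i)
    exact (h1.and (Ioo_mem_nhdsGT hε'0)).exists
  obtain ⟨k₁, Φ₁, C₁, h₁⟩ := hess η hη0
  have hcomb : ∀ c : Fin (k₂ + 1) → ℂ, c ≠ 0 →
      T.quadForm (∑ i, c i • f i) + η * ‖((∑ i, c i • f i : T.domain) : H)‖ ^ 2 < 0 := by
    intro c hc0
    have e : ((∑ i, c i • f i : T.domain) : H) = ∑ i, c i • (f i : H) := by simp
    rw [T.quadForm_sum f hf2, e, norm_sq_sum_of_orthogonal _ hf1, Finset.mul_sum,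
      ← Finset.sum_add_distrib]
    obtain ⟨i, hi⟩ := Function.ne_iff.1 hc0
    have hle : ∀ i, ‖c i‖ ^ 2 * T.quadForm (f i) + η * (‖c i‖ ^ 2 * ‖(f i : H)‖ ^ 2) =
        ‖c i‖ ^ 2 * (T.quadForm (f i) + η * ‖(f i : H)‖ ^ 2) := fun i => by ring
    simp only [hle]
    refine Finset.sum_neg' (fun i _ => ?_) ⟨i, Finset.mem_univ i, ?_⟩
    · exact mul_nonpos_of_nonneg_of_nonpos (by positivity) (hη i).le
    · exact mul_neg_of_pos_of_neg (pow_pos (norm_pos_iff.2 hi) 2) (hη i)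
  let g : Fin (k₂ + 1) → T.FormSpace := f
  have hlin : LinearIndependent ℂ g := by
    rw [Fintype.linearIndependent_iff]
    intro c hc0
    by_contra! hcon
    obtain ⟨i, hi⟩ := hcon
    have h1 := hcomb c fun h => hi (congrFun h i)
    have h2 : (∑ i, c i • f i : T.domain) = 0 := hc0
    rw [h2] at h1
    simp [LinearPMap.quadForm] at h1
  have hMη : 0 < M - η := by linarith
  -- The thresholds are `θ₁ = (M - η)⁻¹` and `θ₂ = (M - ε')⁻¹`, so `l⁻¹ - M` lies in `[-ε', -η)`.
  obtain ⟨l, hl1, hl2, u, w, hw0, hu, huw, hev⟩ := exists_form_eigenvector j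
    (inv_nonneg.2 hMη.le) Φ₁ (bound (by linarith) h₁) Φ₂ (bound hε'M h₂)
    (Submodule.span ℂ (Set.range g))
    (by rw [finrank_span_eq_card hlin]; simp)
    (by
      intro x hx hx0
      obtain ⟨c, rfl⟩ := (Submodule.mem_span_range_iff_exists_fun ℂ).1 hx
      have h1 := hcomb c (by rintro rfl; simp at hx0)
      rw [inv_mul_eq_div, div_lt_iff₀ hMη, hnorm]
      change T.quadForm (∑ i, c i • f i) + M * ‖((∑ i, c i • f i : T.domain) : H)‖ ^ 2 <
        ‖((∑ i, c i • f i : T.domain) : H)‖ ^ 2 * (M - η)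
      linarith)
  have hl0 : 0 < l := (inv_pos.2 hMη).trans hl1
  have hE1 : l⁻¹ < M - η := inv_lt_of_inv_lt₀ hMη hl1
  have hE2 : M - ε' ≤ l⁻¹ := by
    rwa [le_inv_comm₀ (by linarith) hl0]
  -- Unfolding the form inner product in the limit equation shows that `w` solves the eigenvalue
  -- equation weakly, against all of `T.domain`. This puts `w` in the domain of the adjoint.
  have hweak : ∀ v : T.domain, inner ℂ (((l⁻¹ - M : ℝ) : ℂ) • w) (v : H) = inner ℂ w (T v) := by
    intro v
    have h1 := hev v
    have h2 : ∀ n, inner ℂ (show T.FormSpace from v) (u n) =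
        inner ℂ (T v) (j (u n)) + M * inner ℂ (v : H) (j (u n)) := fun n => by
      rw [hin]
      congr 1
      exact (hT.symm v (u n)).symm
    have h3 : Tendsto (fun n => (l : ℂ) *
        (inner ℂ (T v) (j (u n)) + M * inner ℂ (v : H) (j (u n)))) atTop
        (𝓝 ((l : ℂ) * (inner ℂ (T v) w + M * inner ℂ (v : H) w))) :=
      ((tendsto_const_nhds.inner huw).add ((tendsto_const_nhds.inner huw).const_mul _)).const_mul _
    simp only [← h2] at h3
    have h4 : inner ℂ (v : H) w = (l : ℂ) * (inner ℂ (T v) w + M * inner ℂ (v : H) w) :=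
      tendsto_nhds_unique h1 h3
    have hlC : (l : ℂ) ≠ 0 := by exact_mod_cast hl0.ne'
    have h5 : inner ℂ (T v) w = ((l⁻¹ - M : ℝ) : ℂ) * inner ℂ (v : H) w := by
      push_cast
      field_simp
      linear_combination -h4
    rw [inner_smul_left, ← inner_conj_symm w (T v), h5, map_mul, inner_conj_symm]
  have hdom : w ∈ T.adjoint.domain := LinearPMap.mem_adjoint_domain_of_exists w ⟨_, hweak⟩
  -- The sequence `u` is Cauchy in the form norm and its image under `j` is Cauchy in `H`, so the
  -- unshifted form of the differences tends to zero as well.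
  have hform : w ∈ T.formDomain hT := by
    refine ⟨u, huw, ?_⟩
    have h1 : Tendsto (fun p : ℕ × ℕ => u p.1 - u p.2) atTop (𝓝 0) := by
      have := cauchySeq_iff_tendsto.1 hu
      rw [uniformity_eq_comap_nhds_zero_swapped, tendsto_comap_iff] at this
      exact this
    have h2 : Tendsto (fun p : ℕ × ℕ => ‖u p.1 - u p.2‖ ^ 2 - M * ‖j (u p.1 - u p.2)‖ ^ 2) atTop
        (𝓝 (‖(0 : T.FormSpace)‖ ^ 2 - M * ‖j 0‖ ^ 2)) :=
      (h1.norm.pow 2).sub ((((j.continuous.tendsto 0).comp h1).norm.pow 2).const_mul M)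
    rw [_root_.map_zero, norm_zero, norm_zero] at h2
    have h3 : ∀ p : ℕ × ℕ, ‖u p.1 - u p.2‖ ^ 2 - M * ‖j (u p.1 - u p.2)‖ ^ 2 =
        T.quadForm (show T.domain from u p.1 - u p.2) := fun p => by
      rw [hnorm]
      exact add_sub_cancel_right _ _
    have h4 : (0 : ℝ) ^ 2 - M * 0 ^ 2 = 0 := by ring
    simp only [h3] at h2
    rw [h4] at h2
    exact h2
  refine ⟨l⁻¹ - M, ?_, by linarith, ⟨w, hform, hdom⟩, hw0, ?_⟩
  · have : ε' ≤ ε := min_le_left _ _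
    linarith
  · exact LinearPMap.adjoint_apply_eq hT.dense ⟨w, hdom⟩ hweak

/-- If the set were finite it would have a largest element `m < 0`, but there is always an
eigenvalue in `[m / 2, 0)`. -/
theorem LinearPMap.IsSemibounded.infinite_negative_eigenvalues [CompleteSpace H] {T : H →ₗ.[ℂ] H}
    (hT : T.IsSemibounded)
    (hess : ∀ ε : ℝ, 0 < ε → ∃ (k : ℕ) (Φ : H →L[ℂ] EuclideanSpace ℂ (Fin k)) (C : ℝ),
      ∀ x : T.domain, -ε * ‖(x : H)‖ ^ 2 - C * ‖Φ x‖ ^ 2 ≤ T.quadForm x)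
    (hneg : ∀ n : ℕ, ∃ f : Fin n → T.domain,
      (Pairwise fun i k => inner ℂ (f i : H) (f k : H) = 0) ∧
      (Pairwise fun i k => inner ℂ (f i : H) (T (f k)) = 0) ∧ ∀ i, T.quadForm (f i) < 0) :
    {E : ℝ | E < 0 ∧ (T.friedrichsExtension hT).HasEigenvalue (E : ℂ)}.Infinite := by
  intro hfin
  obtain ⟨E₀, _, hE₀, hE₀'⟩ := hT.exists_eigenvalue_mem_Ico hess hneg one_pos
  obtain ⟨m, hm, hmax⟩ := hfin.exists_maximal ⟨E₀, hE₀, hE₀'⟩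
  obtain ⟨E, h1, h2, h3⟩ := hT.exists_eigenvalue_mem_Ico hess hneg
    (show 0 < -m / 2 by linarith [hm.1])
  have h4 : m ≤ E := by linarith [hm.1]
  have h5 := hmax ⟨h2, h3⟩ h4
  linarith [hm.1]

end FriedrichsEigenvalues

/-! ### Poincaré inequalities on intervals, with crude constants. -/

section Poincare

/-- A Poincaré inequality with explicit mean value term. -/
theorem integral_norm_sq_le_poincare {f f' : ℝ → ℂ} (hf : ∀ s, HasDerivAt f (f' s) s)
    (hf' : Continuous f') {a b : ℝ} (hab : a < b) :
    ∫ s in a..b, ‖f s‖ ^ 2 ≤ 2 * (b - a) ^ 2 * (∫ s in a..b, ‖f' s‖ ^ 2) +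
      2 / (b - a) * ‖∫ s in a..b, f s‖ ^ 2 := by
  have hfc : Continuous f := continuous_iff_continuousAt.2 fun s => (hf s).continuousAt
  set l := b - a with hl
  have hl0 : 0 < l := sub_pos.2 hab
  set I := ∫ s in a..b, f s with hI
  set D := ∫ s in a..b, ‖f' s‖ with hD
  set E := ∫ s in a..b, ‖f' s‖ ^ 2 with hE
  have hD0 : 0 ≤ D := intervalIntegral.integral_nonneg hab.le fun s _ => norm_nonneg _
  have hDE : D ^ 2 ≤ l * E := by
    -- Cauchy–Schwarz, obtained by expanding the variance of `‖f'‖` about its mean `D / l`.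
    have h0 : 0 ≤ ∫ s in a..b, (‖f' s‖ - D / l) ^ 2 :=
      intervalIntegral.integral_nonneg hab.le fun s _ => sq_nonneg _
    have h1 : ∫ s in a..b, (‖f' s‖ - D / l) ^ 2 = E - 2 * (D / l) * D + l * (D / l) ^ 2 := by
      have e : ∀ s, (‖f' s‖ - D / l) ^ 2 =
          ‖f' s‖ ^ 2 - 2 * (D / l) * ‖f' s‖ + (D / l) ^ 2 := fun s => by ring
      simp only [e]
      rw [intervalIntegral.integral_add, intervalIntegral.integral_sub,
        intervalIntegral.integral_const_mul, intervalIntegral.integral_const, smul_eq_mul]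
      all_goals exact Continuous.intervalIntegrable (by fun_prop) _ _
    rw [h1] at h0
    have h2 : E - 2 * (D / l) * D + l * (D / l) ^ 2 = (l * E - D ^ 2) / l := by
      field_simp
      ring
    rw [h2] at h0
    have := mul_nonneg h0 hl0.le
    rw [div_mul_cancel₀ _ hl0.ne'] at this
    linarith
  have hosc : ∀ x ∈ Icc a b, ∀ y ∈ Icc a b, ‖f x - f y‖ ≤ D := by
    intro x hx y hy
    rw [← intervalIntegral.integral_eq_sub_of_hasDerivAt (fun s _ => hf s)
      (hf'.intervalIntegrable y x)]
    refine (intervalIntegral.norm_integral_le_abs_integral_norm).trans ?_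
    rw [← abs_of_nonneg hD0]
    refine intervalIntegral.abs_integral_mono_interval ?_ ?_
      (hf'.norm.intervalIntegrable a b)
    · exact uIoc_subset_uIoc_of_uIcc_subset_uIcc
        (uIcc_subset_uIcc (by rwa [uIcc_of_le hab.le]) (by rwa [uIcc_of_le hab.le]))
    · exact Eventually.of_forall fun s => norm_nonneg _
  have hpt : ∀ x ∈ Icc a b, ‖f x‖ ^ 2 ≤ 2 * (‖I‖ / l) ^ 2 + 2 * (l * E) := by
    intro x hx
    -- Averaging `f x - f y` over `y` shows that `f x` is within the oscillation bound `D` of the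
    -- mean `I / l`.
    have h1 : (l : ℂ) * f x - I = ∫ y in a..b, (f x - f y) := by
      rw [intervalIntegral.integral_sub (by simp) (hfc.intervalIntegrable a b),
        intervalIntegral.integral_const, Complex.real_smul]
    have h2 : ‖(l : ℂ) * f x - I‖ ≤ D * l := by
      rw [h1]
      refine (intervalIntegral.norm_integral_le_of_norm_le_const fun y hy => ?_).trans_eq
        (by rw [abs_of_pos hl0])
      rw [uIoc_of_le hab.le] at hy
      exact hosc x hx y ⟨hy.1.le, hy.2⟩
    have h3 : l * ‖f x‖ ≤ ‖I‖ + D * l := by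
      have e : l * ‖f x‖ = ‖(l : ℂ) * f x‖ := by
        rw [norm_mul, Complex.norm_real, Real.norm_of_nonneg hl0.le]
      rw [e]
      have := norm_add_le ((l : ℂ) * f x - I) I
      rw [sub_add_cancel] at this
      linarith
    have h4 : ‖f x‖ ≤ ‖I‖ / l + D := by
      rw [← mul_le_mul_iff_of_pos_left hl0]
      refine h3.trans_eq ?_
      field_simp
    have h5 : ‖f x‖ ^ 2 ≤ (‖I‖ / l + D) ^ 2 := by gcongr
    nlinarith [sq_nonneg (‖I‖ / l - D)]
  calc ∫ s in a..b, ‖f s‖ ^ 2 ≤ ∫ _ in a..b, (2 * (‖I‖ / l) ^ 2 + 2 * (l * E)) :=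
        intervalIntegral.integral_mono_on hab.le
          (Continuous.intervalIntegrable (by fun_prop) _ _) (by simp) hpt
    _ = _ := by
        rw [intervalIntegral.integral_const, smul_eq_mul, ← hl]
        field_simp
        ring

/-- The Poincaré inequality on a subdivision into `N` intervals. -/
theorem integral_norm_sq_le_sum_mean {f f' : ℝ → ℂ} (hf : ∀ s, HasDerivAt f (f' s) s)
    (hf' : Continuous f') {l : ℝ} (hl : 0 < l) (N : ℕ) :
    ∫ s in (0)..(N * l), ‖f s‖ ^ 2 ≤ 2 * l ^ 2 * (∫ s in (0)..(N * l), ‖f' s‖ ^ 2) +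
      2 / l * ∑ i ∈ Finset.range N, ‖∫ s in (i * l)..((i + 1 : ℕ) * l), f s‖ ^ 2 := by
  have hfc : Continuous f := continuous_iff_continuousAt.2 fun s => (hf s).continuousAt
  have split : ∀ g : ℝ → ℝ, Continuous g → ∫ s in (0)..(N * l), g s =
      ∑ i ∈ Finset.range N, ∫ s in (i * l)..((i + 1 : ℕ) * l), g s := fun g hg => by
    have := intervalIntegral.sum_integral_adjacent_intervals (f := g) (μ := volume)
      (a := fun i : ℕ => (i : ℝ) * l) (n := N) (fun k _ => hg.intervalIntegrable _ _)
    rw [this]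
    simp
  rw [split _ (by fun_prop), split _ (by fun_prop), Finset.mul_sum, Finset.mul_sum,
    ← Finset.sum_add_distrib]
  refine Finset.sum_le_sum fun i _ => ?_
  have e : ((i + 1 : ℕ) : ℝ) * l - i * l = l := by push_cast; ring
  have := integral_norm_sq_le_poincare hf hf' (a := i * l) (b := (i + 1 : ℕ) * l) (by linarith)
  rwa [e] at this

end Poincare

/-! ### The form is almost nonnegative modulo finite rank. -/

section LowerBound

theorem quadForm_minimalOp (d : ℕ) (q μ : ℝ) (f : 𝓓(halfLine, ℂ)) :
    (minimalOp d q μ).quadForm ⟨testToL2 f, ⟨f, rfl⟩⟩ =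
      ∫ s in Ioi (0 : ℝ), (conj (f s) * schrodingerExpr (peakPotential d q μ) f s).re := by
  rw [LinearPMap.quadForm, minimalOp_apply]
  change RCLike.re (inner ℂ (f.memLp_halfLine.toLp f)
    ((f.memLp_schrodingerExpr d q μ).toLp _)) = _
  rw [inner_halfLine_toLp]
  have hc : Continuous fun s => conj (f s) * schrodingerExpr (peakPotential d q μ) f s :=
    (Complex.continuous_conj.comp f.continuous).mul (f.continuous_schrodingerExpr d q μ)
  exact (integral_re (integrableOn_halfLine_of_off f.hasCompactSupport f.tsupport_subset
    hc.continuousOn fun s hs => by simp [f.eq_zero_off hs])).symm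

theorem norm_sq_testToL2 (f : 𝓓(halfLine, ℂ)) :
    ‖testToL2 f‖ ^ 2 = ∫ s in Ioi (0 : ℝ), ‖f s‖ ^ 2 := by
  rw [norm_sq_eq_re_inner (𝕜 := ℂ)]
  change RCLike.re (inner ℂ (f.memLp_halfLine.toLp f) (f.memLp_halfLine.toLp f)) = _
  rw [inner_halfLine_toLp, ← integral_re]
  · refine integral_congr_ae (Eventually.of_forall fun s => ?_)
    change (conj (f s) * f s).re = _
    rw [← Complex.normSq_eq_conj_mul_self, Complex.normSq_eq_norm_sq, Complex.ofReal_re]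
  · exact integrableOn_halfLine_of_off f.hasCompactSupport f.tsupport_subset
      ((Complex.continuous_conj.comp f.continuous).mul f.continuous).continuousOn
      fun s hs => by simp [f.eq_zero_off hs]

/-- Hardy's inequality, in a form which retains a fraction `δ` of the kinetic energy. -/
theorem integral_le_quadForm_minimalOp {d : ℕ} {q μ δ : ℝ} (hδ : δ ≤ 1) (f : 𝓓(halfLine, ℂ))
    {g : ℝ → ℝ} (hg : IntegrableOn g (Ioi 0))
    (hgf : ∀ s, 0 < s → g s ≤ δ * ‖deriv f s‖ ^ 2 +
      (peakPotential d q μ s + (1 - δ) / (4 * s ^ 2)) * ‖f s‖ ^ 2) :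
    ∫ s in Ioi (0 : ℝ), g s ≤ (minimalOp d q μ).quadForm ⟨testToL2 f, ⟨f, rfl⟩⟩ := by
  rw [quadForm_minimalOp]
  have c2 : Continuous fun s => conj (f s) * schrodingerExpr (peakPotential d q μ) f s :=
    (Complex.continuous_conj.comp f.continuous).mul (f.continuous_schrodingerExpr d q μ)
  have i2 := integrableOn_halfLine_of_off f.hasCompactSupport f.tsupport_subset c2.continuousOn
    (fun s hs => by simp [f.eq_zero_off hs])
  -- Adding the total derivative `k'` does not change the integral. After this, the integrand of the
  -- form exceeds `g + k'` by the slack in `hgf` plus `(1 - δ) ‖f' - f / (2s)‖²`, so the comparison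
  -- becomes pointwise.
  set k : ℝ → ℝ := fun s => ((1 - δ) / (2 * s)) * (conj (f s) * f s).re -
    (conj (f s) * deriv f s).re
  set k' : ℝ → ℝ := fun s =>
    (-(1 - δ) / (2 * s ^ 2)) * (conj (f s) * f s).re
      + ((1 - δ) / (2 * s)) * (conj (deriv f s) * f s + conj (f s) * deriv f s).re
      - (conj (deriv f s) * deriv f s + conj (f s) * deriv (deriv f) s).re with hk'
  have ck' : ContinuousOn k' (Ioi 0) := by
    have a1 : Continuous (deriv f) := f.contDiff_deriv.continuous
    have a2 := f.continuous_deriv_two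
    have a3 := f.continuous
    have b1 : ContinuousOn (fun s : ℝ => -(1 - δ) / (2 * s ^ 2)) (Ioi 0) :=
      continuousOn_const.div (by fun_prop) fun s (hs : 0 < s) => by positivity
    have b2 : ContinuousOn (fun s : ℝ => (1 - δ) / (2 * s)) (Ioi 0) :=
      continuousOn_const.div (by fun_prop) fun s (hs : 0 < s) => by positivity
    refine ((b1.mul (Continuous.continuousOn ?_)).add
      (b2.mul (Continuous.continuousOn ?_))).sub (Continuous.continuousOn ?_) <;> fun_prop
  have k'0 : ∀ s, s ∉ tsupport f → k' s = 0 := fun s hs => by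
    simp [hk', f.eq_zero_off hs, f.deriv_eq_zero_off hs]
  have ik' := integrableOn_halfLine_of_off f.hasCompactSupport f.tsupport_subset ck' k'0
  have zk' : ∫ s in Ioi (0 : ℝ), k' s = 0 := by
    refine integral_halfLine_deriv_eq_zero (h := k) f.hasCompactSupport f.tsupport_subset
      ?_ ck' (fun s hs => by simp [k, f.eq_zero_off hs]) k'0
    intro s hs
    have d0 : HasDerivAt (fun s : ℝ => (1 - δ) / (2 * s)) (-(1 - δ) / (2 * s ^ 2)) s := by
      have := (((hasDerivAt_id s).const_mul 2).inv (by simpa using hs.ne')).const_mul (1 - δ)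
      simp only [div_eq_mul_inv]
      refine this.congr_deriv ?_
      simp only [id]
      field_simp
    have d1 := Complex.reCLM.hasFDerivAt.comp_hasDerivAt s
      ((f.hasDerivAt_one s).star.mul (f.hasDerivAt_one s))
    have d2 := Complex.reCLM.hasFDerivAt.comp_hasDerivAt s
      ((f.hasDerivAt_one s).star.mul (f.hasDerivAt_two s))
    exact ((d0.mul d1).sub d2)
  have j2 : IntegrableOn
      (fun s => (conj (f s) * schrodingerExpr (peakPotential d q μ) f s).re) (Ioi 0) := i2.re
  calc ∫ s in Ioi (0 : ℝ), g s = ∫ s in Ioi (0 : ℝ), (g s + k' s) := by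
        rw [integral_add hg ik', zk', add_zero]
    _ ≤ _ := by
        refine setIntegral_mono_on (hg.add ik') j2 measurableSet_Ioi fun s (hs : 0 < s) => ?_
        have hm := hgf s hs
        have hsq1 := mul_nonneg (sub_nonneg.2 hδ)
          (sq_nonneg ((deriv f s).re - (1 / (2 * s)) * (f s).re))
        have hsq2 := mul_nonneg (sub_nonneg.2 hδ)
          (sq_nonneg ((deriv f s).im - (1 / (2 * s)) * (f s).im))
        have e1 : (1 - δ) / (4 * s ^ 2) = (1 - δ) * (1 / (2 * s)) ^ 2 := by
          field_simp
          norm_num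
        have e2 : -(1 - δ) / (2 * s ^ 2) = -2 * (1 - δ) * (1 / (2 * s)) ^ 2 := by field_simp
        have e3 : (1 - δ) / (2 * s) = (1 - δ) * (1 / (2 * s)) := by ring
        rw [e1, ← Complex.normSq_eq_norm_sq, ← Complex.normSq_eq_norm_sq, Complex.normSq_apply,
          Complex.normSq_apply] at hm
        simp only [hk', schrodingerExpr, e2, e3]
        simp only [Complex.add_re, Complex.mul_re, Complex.conj_re, Complex.conj_im,
          Complex.neg_re, Complex.neg_im, Complex.ofReal_re, Complex.ofReal_im, Complex.add_im,
          Complex.mul_im]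
        linarith

/-- The potential is bounded from below by a fraction of the Hardy weight, up to an arbitrarily
small constant and a bounded potential supported near the origin. -/
theorem exists_peakPotential_lower_bound {d : ℕ} (hd : 2 ≤ d) {q : ℝ} (hq1 : 1 < q) (hq2 : q < 2)
    {μ : ℝ} (hμ : 0 < μ) {ε : ℝ} (hε : 0 < ε) :
    ∃ δ W r : ℝ, 0 < δ ∧ δ ≤ 1 ∧ 0 < W ∧ 0 < r ∧ ∀ s : ℝ, 0 < s →
      -ε - (Iic r).indicator (fun _ => W) s ≤ peakPotential d q μ s + (1 - δ) / (4 * s ^ 2) := by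
  have hd' : (1 : ℝ) ≤ (d : ℝ) - 1 := by
    have : (2 : ℝ) ≤ d := by exact_mod_cast hd
    linarith
  set p : ℝ := q * ((d : ℝ) - 1) with hp
  have hp1 : 1 < p := by nlinarith
  have hp0 : 0 < p - 1 := by linarith
  -- The surplus over the Hardy weight is `(p - 1)² / (4s²)`. Giving up `δ / (4s²)` costs at most
  -- half of it and leaves at least `γ / s²`.
  set δ : ℝ := min 1 ((p - 1) ^ 2 / 2) with hδ
  have hδ0 : 0 < δ := by positivity
  set γ : ℝ := (p - 1) ^ 2 / 8 with hγ
  have hγ0 : 0 < γ := by positivity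
  -- At `s₀` the terms `γ / s²` and `μ / s^q` are equal. Below it the repulsion dominates, above it
  -- the attraction is at most `μ / s₀ ^ q`. The radius `r` is where the attraction equals `ε`.
  set s₀ : ℝ := (γ / μ) ^ (1 / (2 - q)) with hs₀
  have hs₀p : 0 < s₀ := by positivity
  set r : ℝ := (μ / ε) ^ (1 / q) with hr
  have hr0 : 0 < r := by positivity
  refine ⟨δ, μ / s₀ ^ q, r, hδ0, min_le_left _ _, by positivity, hr0, fun s hs => ?_⟩
  have hlow : γ / s ^ 2 - μ / s ^ q ≤ peakPotential d q μ s + (1 - δ) / (4 * s ^ 2) := by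
    have e : peakPotential d q μ s + (1 - δ) / (4 * s ^ 2) - (γ / s ^ 2 - μ / s ^ q) =
        ((p - 1) ^ 2 / 2 - δ) / (4 * s ^ 2) := by
      unfold peakPotential
      have : q ^ 2 * ((d : ℝ) - 1) ^ 2 - 2 * q * ((d : ℝ) - 1) = p ^ 2 - 2 * p := by
        rw [hp]; ring
      rw [this, hγ]
      field_simp
      ring
    have h : 0 ≤ ((p - 1) ^ 2 / 2 - δ) / (4 * s ^ 2) :=
      div_nonneg (sub_nonneg.2 (min_le_right _ _)) (by positivity)
    linarith
  refine le_trans ?_ hlow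
  have hsq : 0 < s ^ q := by positivity
  have hE : 0 < γ / s ^ 2 := by positivity
  by_cases hsr : s ≤ r
  · rw [indicator_of_mem (show s ∈ Iic r from hsr)]
    suffices μ / s ^ q ≤ γ / s ^ 2 + μ / s₀ ^ q by linarith
    have hC : 0 < μ / s₀ ^ q := by positivity
    rcases le_total s s₀ with h | h
    · have h1 : s ^ (2 - q) ≤ γ / μ := by
        calc s ^ (2 - q) ≤ s₀ ^ (2 - q) := Real.rpow_le_rpow hs.le h (by linarith)
          _ = γ / μ := by
            rw [hs₀, ← Real.rpow_mul (by positivity), one_div_mul_cancel (by linarith),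
              Real.rpow_one]
      have h2 : s ^ (2 - q) * s ^ q = s ^ 2 := by
        rw [← Real.rpow_add hs, ← Real.rpow_natCast]
        norm_num
      have h4 : μ / s ^ q ≤ γ / s ^ 2 := by
        rw [div_le_div_iff₀ hsq (by positivity), ← h2]
        rw [le_div_iff₀ hμ] at h1
        nlinarith
      linarith
    · have : μ / s ^ q ≤ μ / s₀ ^ q :=
        div_le_div_of_nonneg_left hμ.le (by positivity)
          (Real.rpow_le_rpow hs₀p.le h (by linarith))
      linarith
  · rw [indicator_of_notMem (show s ∉ Iic r from hsr)]
    have h1 : r ^ q ≤ s ^ q := Real.rpow_le_rpow hr0.le (not_le.1 hsr).le (by linarith)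
    have h2 : r ^ q = μ / ε := by
      rw [hr, ← Real.rpow_mul (by positivity), one_div_mul_cancel (by linarith), Real.rpow_one]
    have h3 : μ / s ^ q ≤ ε := by
      rw [div_le_iff₀ hsq]
      rw [h2, div_le_iff₀ hε] at h1
      linarith
    linarith

/-- The means of an `L²` function over the intervals `(i l, (i + 1) l]`, `i < N`. -/
def meansOnIntervals (l : ℝ) (N : ℕ) : HalfLineL2 →L[ℂ] EuclideanSpace ℂ (Fin N) :=
  (EuclideanSpace.equiv (Fin N) ℂ).symm.toContinuousLinearMap ∘L
    ContinuousLinearMap.pi fun i : Fin N => innerSL ℂ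
      (indicatorConstLp 2 (μ := halfLineMeasure)
        (measurableSet_Ioc : MeasurableSet (Ioc ((i : ℕ) * l) (((i : ℕ) + 1 : ℕ) * l)))
        (measure_ne_top_of_subset Ioc_subset_Icc_self isCompact_Icc.measure_lt_top.ne) (1 : ℂ))

theorem meansOnIntervals_testToL2 {l : ℝ} (hl : 0 < l) (N : ℕ) (f : 𝓓(halfLine, ℂ)) (i : Fin N) :
    meansOnIntervals l N (testToL2 f) i =
      ∫ s in ((i : ℕ) * l)..(((i : ℕ) + 1 : ℕ) * l), f s := by
  change inner ℂ (indicatorConstLp 2 _ _ (1 : ℂ)) (testToL2 f) = _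
  have h0 : (0 : ℝ) ≤ (i : ℕ) * l := by positivity
  have hsub : Ioc ((i : ℕ) * l) (((i : ℕ) + 1 : ℕ) * l) ⊆ Ioi 0 :=
    fun s hs => lt_of_le_of_lt h0 hs.1
  rw [L2.inner_indicatorConstLp_one, intervalIntegral.integral_of_le (by push_cast; linarith),
    Measure.restrict_restrict measurableSet_Ioc,
    inter_eq_left.2 hsub]
  refine integral_congr_ae ?_
  have h := f.memLp_halfLine.coeFn_toLp
  exact ae_restrict_of_ae_restrict_of_subset hsub h

/-- The well of depth `W` on `(0, r]` is cut into `N` short intervals. On each, the Poincaré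
inequality bounds `∫ ‖f‖²` by a small multiple of the kinetic energy and the integral of `f`. The
retained fraction `δ` of kinetic energy pays for the former, and the `N` integrals form the
finite-rank term. -/
theorem exists_minimalOp_quadForm_lower_bound {d : ℕ} (hd : 2 ≤ d) {q : ℝ} (hq1 : 1 < q)
    (hq2 : q < 2) {μ : ℝ} (hμ : 0 < μ) {ε : ℝ} (hε : 0 < ε) :
    ∃ (k : ℕ) (Φ : HalfLineL2 →L[ℂ] EuclideanSpace ℂ (Fin k)) (C : ℝ),
      ∀ x : (minimalOp d q μ).domain,
        -ε * ‖(x : HalfLineL2)‖ ^ 2 - C * ‖Φ x‖ ^ 2 ≤ (minimalOp d q μ).quadForm x := by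
  obtain ⟨δ, W, r, hδ0, hδ1, hW, hr, hV⟩ := exists_peakPotential_lower_bound hd hq1 hq2 hμ hε
  -- With `l = r / N` one needs `2 r² W ≤ δ N²`. The bound `N > 1` lets `N² ≥ N` reduce this to a
  -- linear condition.
  obtain ⟨N, hN⟩ := exists_nat_gt (max 1 (2 * r ^ 2 * W / δ))
  have hN1 : (1 : ℝ) < N := (le_max_left _ _).trans_lt hN
  have hN0 : (0 : ℝ) < N := by linarith
  set l : ℝ := r / N with hl
  have hl0 : 0 < l := by positivity
  have hNl : N * l = r := by
    rw [hl]
    field_simp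
  have hlW : W * (2 * l ^ 2) ≤ δ := by
    have h1 : 2 * r ^ 2 * W / δ < N := (le_max_right _ _).trans_lt hN
    rw [div_lt_iff₀ hδ0] at h1
    have h2 : W * (2 * l ^ 2) = 2 * r ^ 2 * W / N ^ 2 := by
      rw [hl]
      ring
    rw [h2, div_le_iff₀ (by positivity)]
    nlinarith [mul_pos hδ0 hN0]
  -- The components of `meansOnIntervals` are integrals, not divided by the length, so the constant
  -- is `W` times the Poincaré coefficient `2 / l`.
  refine ⟨N, meansOnIntervals l N, W * (2 / l), ?_⟩
  rintro ⟨_, f, rfl⟩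
  have cf := f.continuous
  have cf' : Continuous (deriv f) := f.contDiff_deriv.continuous
  have i1 : IntegrableOn (fun s => ‖deriv f s‖ ^ 2) (Ioi 0) :=
    integrableOn_halfLine_of_off f.hasCompactSupport f.tsupport_subset
      (Continuous.continuousOn (by fun_prop)) fun s hs => by simp [f.deriv_eq_zero_off hs]
  have i2 : IntegrableOn (fun s => ‖f s‖ ^ 2) (Ioi 0) :=
    integrableOn_halfLine_of_off f.hasCompactSupport f.tsupport_subset
      (Continuous.continuousOn (by fun_prop)) fun s hs => by simp [f.eq_zero_off hs]
  have i3 : IntegrableOn ((Iic r).indicator fun s => W * ‖f s‖ ^ 2) (Ioi 0) :=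
    (i2.const_mul W).indicator measurableSet_Iic
  have key := integral_le_quadForm_minimalOp (d := d) (q := q) (μ := μ) hδ1 f
    (((i1.const_mul δ).sub (i2.const_mul ε)).sub i3) (fun s hs => by
      have h := mul_le_mul_of_nonneg_right (hV s hs) (sq_nonneg ‖f s‖)
      have e : (Iic r).indicator (fun s => W * ‖f s‖ ^ 2) s =
          (Iic r).indicator (fun _ => W) s * ‖f s‖ ^ 2 := indicator_mul_left _ _ _
      simp only [Pi.sub_apply, e]
      linarith)
  refine le_trans ?_ key
  have hcut : Ioi (0 : ℝ) ∩ Iic r = Ioc 0 r := Ioi_inter_Iic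
  rw [integral_sub' ((i1.const_mul δ).sub (i2.const_mul ε)) i3,
    integral_sub' (i1.const_mul δ) (i2.const_mul ε), integral_const_mul, integral_const_mul,
    setIntegral_indicator measurableSet_Iic, hcut, integral_const_mul]
  have hP := integral_norm_sq_le_sum_mean f.hasDerivAt_one cf' hl0 N
  rw [hNl, intervalIntegral.integral_of_le hr.le, intervalIntegral.integral_of_le hr.le] at hP
  have hmono : ∫ s in Ioc 0 r, ‖deriv f s‖ ^ 2 ≤ ∫ s in Ioi (0 : ℝ), ‖deriv f s‖ ^ 2 :=
    setIntegral_mono_set i1 (Eventually.of_forall fun s => by positivity)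
      (Ioc_subset_Ioi_self).eventuallyLE
  have hΦ : ‖meansOnIntervals l N (testToL2 f)‖ ^ 2 =
      ∑ i ∈ Finset.range N, ‖∫ s in (i * l)..((i + 1 : ℕ) * l), f s‖ ^ 2 := by
    rw [EuclideanSpace.norm_sq_eq, Finset.sum_range]
    exact Finset.sum_congr rfl fun i _ => by rw [meansOnIntervals_testToL2 hl0]
  rw [← hΦ] at hP
  change -ε * ‖testToL2 f‖ ^ 2 - W * (2 / l) * ‖meansOnIntervals l N (testToL2 f)‖ ^ 2 ≤ _
  rw [norm_sq_testToL2]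
  have h1 := mul_le_mul_of_nonneg_left hP hW.le
  have h0 : 0 ≤ ∫ s in Ioc 0 r, ‖deriv f s‖ ^ 2 := integral_nonneg fun s => by positivity
  have h2 := mul_le_mul_of_nonneg_right hlW h0
  have h3 := mul_le_mul_of_nonneg_left hmono hδ0.le
  linarith

end LowerBound

/-! ### Arbitrarily many orthogonal directions of negative energy, by dilation. -/

section NegativeDirections

/-- The dilation `s ↦ f (c s)` of a test function. -/
def TestFunction.dilate (f : 𝓓(halfLine, ℂ)) {c : ℝ} (hc : 0 < c) : 𝓓(halfLine, ℂ) where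
  toFun s := f (c * s)
  contDiff' := f.contDiff.comp (contDiff_const.mul contDiff_id)
  hasCompactSupport' := f.hasCompactSupport.comp_homeomorph (Homeomorph.mulLeft₀ c hc.ne')
  tsupport_subset' s hs := by
    have h : s ∈ (fun t => c * t) ⁻¹' tsupport f :=
      tsupport_comp_subset_preimage f (continuous_const.mul continuous_id) hs
    exact (mul_pos_iff_of_pos_left hc).1 (f.pos_of_mem h)

theorem TestFunction.dilate_apply (f : 𝓓(halfLine, ℂ)) {c : ℝ} (hc : 0 < c) (s : ℝ) :
    f.dilate hc s = f (c * s) := rfl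

theorem TestFunction.deriv_two_dilate (f : 𝓓(halfLine, ℂ)) {c : ℝ} (hc : 0 < c) (s : ℝ) :
    deriv (deriv (f.dilate hc)) s = c ^ 2 * deriv (deriv f) (c * s) := by
  have h1 : deriv (f.dilate hc) = fun t => c • deriv f (c * t) := by
    funext t
    exact deriv_comp_mul_left c f t
  rw [h1, deriv_fun_const_smul_field, deriv_comp_mul_left, smul_smul, Complex.real_smul]
  push_cast
  ring

/-- Under dilations the quadratic form scales like its kinetic and centrifugal parts, except for
the attractive part of the potential. -/
theorem quadForm_minimalOp_dilate (d : ℕ) (q μ : ℝ) (f : 𝓓(halfLine, ℂ)) {c : ℝ} (hc : 0 < c) :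
    (minimalOp d q μ).quadForm ⟨testToL2 (f.dilate hc), ⟨f.dilate hc, rfl⟩⟩ =
      c⁻¹ * (c ^ 2 * (minimalOp d q 0).quadForm ⟨testToL2 f, ⟨f, rfl⟩⟩ -
        c ^ q * (μ * ∫ s in Ioi (0 : ℝ), ‖f s‖ ^ 2 / s ^ q)) := by
  rw [quadForm_minimalOp, quadForm_minimalOp]
  set A : ℝ → ℝ := fun s => (conj (f s) * schrodingerExpr (peakPotential d q 0) f s).re with hA
  set B : ℝ → ℝ := fun s => ‖f s‖ ^ 2 / s ^ q with hB
  have iA : IntegrableOn A (Ioi 0) := by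
    have hcont : Continuous A := Complex.continuous_re.comp
      ((Complex.continuous_conj.comp f.continuous).mul (f.continuous_schrodingerExpr d q 0))
    exact integrableOn_halfLine_of_off f.hasCompactSupport f.tsupport_subset
      hcont.continuousOn fun s hs => by simp [hA, f.eq_zero_off hs]
  have iB : IntegrableOn B (Ioi 0) := by
    refine integrableOn_halfLine_of_off f.hasCompactSupport f.tsupport_subset
      ((f.continuous.norm.pow 2).continuousOn.div ?_ fun s (hs : 0 < s) => by positivity)
      fun s hs => by simp [hB, f.eq_zero_off hs]
    exact fun s (hs : 0 < s) =>
      (Real.continuousAt_rpow_const _ _ (Or.inl hs.ne')).continuousWithinAt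
  have e : ∀ s ∈ Ioi (0 : ℝ), (conj (f.dilate hc s) *
      schrodingerExpr (peakPotential d q μ) (f.dilate hc) s).re =
      (fun t => c ^ 2 * A t - c ^ q * (μ * B t)) (c * s) := by
    intro s hs
    have hs0 : 0 < s := hs
    have hV : peakPotential d q μ s =
        c ^ 2 * peakPotential d q 0 (c * s) - c ^ q * (μ / (c * s) ^ q) := by
      unfold peakPotential
      rw [Real.mul_rpow hc.le hs0.le]
      have h1 : s ^ q ≠ 0 := by positivity
      have h2 : c ^ q ≠ 0 := by positivity
      field_simp
      ring
    have hn : ‖f (c * s)‖ ^ 2 = (f (c * s)).re ^ 2 + (f (c * s)).im ^ 2 := by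
      rw [← Complex.normSq_eq_norm_sq, Complex.normSq_apply]
      ring
    simp only [hA, hB, hn, schrodingerExpr, f.deriv_two_dilate hc, f.dilate_apply hc, hV,
      ← Complex.ofReal_pow, Complex.add_re, Complex.mul_re, Complex.conj_re, Complex.conj_im,
      Complex.neg_re, Complex.neg_im, Complex.ofReal_re, Complex.ofReal_im, Complex.add_im,
      Complex.mul_im]
    ring
  rw [setIntegral_congr_fun measurableSet_Ioi e, integral_comp_mul_left_Ioi
      (fun t => c ^ 2 * A t - c ^ q * (μ * B t)) 0 hc, mul_zero,
    smul_eq_mul, integral_sub (iA.const_mul _) ((iB.const_mul _).const_mul _),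
    integral_const_mul, integral_const_mul, integral_const_mul]

/-- The dilated energy is `c⁻¹ c^q (c^(2-q) a - μ b)` with `b > 0`, and `c^(2-q)` tends to zero with
`c` because `q < 2`: at large length scales the attraction beats every term that scales like `1/s²`.
-/
theorem exists_quadForm_minimalOp_dilate_neg (d : ℕ) {q : ℝ} (hq2 : q < 2) {μ : ℝ}
    (hμ : 0 < μ) (f : 𝓓(halfLine, ℂ)) (hf : f ≠ 0) :
    ∃ c₀ : ℝ, 0 < c₀ ∧ ∀ c, ∀ hc : 0 < c, c < c₀ →
      (minimalOp d q μ).quadForm ⟨testToL2 (f.dilate hc), ⟨f.dilate hc, rfl⟩⟩ < 0 := by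
  set a := (minimalOp d q 0).quadForm ⟨testToL2 f, ⟨f, rfl⟩⟩ with ha
  set b := ∫ s in Ioi (0 : ℝ), ‖f s‖ ^ 2 / s ^ q with hb
  have hb0 : 0 < b := by
    have hcont : ContinuousOn (fun s => ‖f s‖ ^ 2 / s ^ q) (Ioi 0) :=
      (f.continuous.norm.pow 2).continuousOn.div (fun s (hs : 0 < s) =>
        (Real.continuousAt_rpow_const _ _ (Or.inl hs.ne')).continuousWithinAt)
        fun s (hs : 0 < s) => by positivity
    have hint : IntegrableOn (fun s => ‖f s‖ ^ 2 / s ^ q) (Ioi 0) :=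
      integrableOn_halfLine_of_off f.hasCompactSupport f.tsupport_subset hcont
        fun s hs => by simp [f.eq_zero_off hs]
    rw [hb, setIntegral_pos_iff_support_of_nonneg_ae
      (ae_restrict_of_forall_mem measurableSet_Ioi fun s (hs : 0 < s) => by
        change 0 ≤ ‖f s‖ ^ 2 / s ^ q
        positivity) hint]
    have hsub : Function.support f ⊆
        Function.support (fun s => ‖f s‖ ^ 2 / s ^ q) ∩ Ioi 0 := fun s hs => by
      have hs0 : 0 < s := f.pos_of_mem (subset_tsupport f hs)
      have hfs : 0 < ‖f s‖ := norm_pos_iff.2 hs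
      exact ⟨(by positivity : 0 < ‖f s‖ ^ 2 / s ^ q).ne', hs0⟩
    refine lt_of_lt_of_le (f.continuous.isOpen_support.measure_pos volume ?_) (measure_mono hsub)
    by_contra hne
    rw [not_nonempty_iff_eq_empty, Function.support_eq_empty_iff] at hne
    exact hf (DFunLike.coe_injective hne)
  have hlim : Tendsto (fun c : ℝ => c ^ (2 - q) * a) (𝓝[>] 0) (𝓝 0) := by
    have h : Tendsto (fun c : ℝ => c ^ (2 - q)) (𝓝 0) (𝓝 0) := by
      have := (Real.continuousAt_rpow_const 0 (2 - q) (Or.inr (by linarith))).tendsto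
      rwa [Real.zero_rpow (by linarith)] at this
    simpa using (h.mono_left nhdsWithin_le_nhds).mul_const a
  obtain ⟨c₀, hc₀, hc₀'⟩ := mem_nhdsGT_iff_exists_Ioo_subset.1
    (hlim.eventually_lt_const (mul_pos hμ hb0))
  refine ⟨c₀, hc₀, fun c hc hcc => ?_⟩
  rw [quadForm_minimalOp_dilate]
  have h1 : c ^ (2 - q) * a < μ * b := hc₀' ⟨hc, hcc⟩
  have h2 : c ^ 2 = c ^ q * c ^ (2 - q) := by
    rw [← Real.rpow_add hc, ← Real.rpow_natCast]
    norm_num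
  rw [h2, mul_assoc, ← mul_sub]
  exact mul_neg_of_pos_of_neg (by positivity)
    (mul_neg_of_pos_of_neg (by positivity) (sub_neg.2 h1))

theorem inner_testToL2_eq_zero {f g : 𝓓(halfLine, ℂ)}
    (h : Disjoint (tsupport f) (tsupport g)) : inner ℂ (testToL2 f) (testToL2 g) = 0 := by
  change inner ℂ (f.memLp_halfLine.toLp f) (g.memLp_halfLine.toLp g) = 0
  rw [inner_halfLine_toLp]
  refine integral_eq_zero_of_ae (Eventually.of_forall fun s => ?_)
  by_cases hs : s ∈ tsupport f
  · simp [g.eq_zero_off (h.notMem_of_mem_left hs)]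
  · simp [f.eq_zero_off hs]

theorem inner_testToL2_schrodingerToL2_eq_zero (d : ℕ) (q μ : ℝ) {f g : 𝓓(halfLine, ℂ)}
    (h : Disjoint (tsupport f) (tsupport g)) :
    inner ℂ (testToL2 f) (schrodingerToL2 d q μ g) = 0 := by
  change inner ℂ (f.memLp_halfLine.toLp f) ((g.memLp_schrodingerExpr d q μ).toLp _) = 0
  rw [inner_halfLine_toLp]
  refine integral_eq_zero_of_ae (Eventually.of_forall fun s => ?_)
  by_cases hs : s ∈ tsupport f
  · simp [g.schrodingerExpr_eq_zero_off _ (h.notMem_of_mem_left hs)]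
  · simp [f.eq_zero_off hs]

/-- The endpoints of the interval have ratio `3/2 < 2`, so dilations whose factors differ by at
least `2` have disjoint supports. -/
theorem exists_testFunction_tsupport_subset_Icc :
    ∃ f : 𝓓(halfLine, ℂ), f ≠ 0 ∧ tsupport f ⊆ Icc 1 (3 / 2) := by
  let χ : ContDiffBump (5 / 4 : ℝ) := ⟨1 / 8, 1 / 4, by norm_num, by norm_num⟩
  have hsub : tsupport (fun s => (χ s : ℂ)) ⊆ Icc 1 (3 / 2) := by
    refine (closure_mono (Function.support_comp_subset Complex.ofReal_zero χ)).trans ?_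
    have h : tsupport χ = Metric.closedBall (5 / 4) (1 / 4) := χ.tsupport_eq
    change tsupport χ ⊆ _
    rw [h, Real.closedBall_eq_Icc]
    norm_num
  refine ⟨⟨fun s => (χ s : ℂ), Complex.ofRealCLM.contDiff.comp χ.contDiff,
    χ.hasCompactSupport.comp_left Complex.ofReal_zero,
    hsub.trans fun s hs => lt_of_lt_of_le one_pos hs.1⟩, fun h => ?_, hsub⟩
  have h1 : (χ (5 / 4) : ℂ) = 0 := DFunLike.congr_fun h (5 / 4)
  have h2 : χ (5 / 4) = 1 := χ.one_of_mem_closedBall (by simp [χ])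
  rw [h2] at h1
  simp at h1

theorem exists_orthogonal_quadForm_minimalOp_neg (d : ℕ) {q : ℝ} (hq2 : q < 2) {μ : ℝ}
    (hμ : 0 < μ) (n : ℕ) :
    ∃ f : Fin n → (minimalOp d q μ).domain,
      (Pairwise fun i k => inner ℂ (f i : HalfLineL2) (f k : HalfLineL2) = 0) ∧
      (Pairwise fun i k => inner ℂ (f i : HalfLineL2) (minimalOp d q μ (f k)) = 0) ∧
      ∀ i, (minimalOp d q μ).quadForm (f i) < 0 := by
  obtain ⟨f, hf, hfs⟩ := exists_testFunction_tsupport_subset_Icc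
  obtain ⟨c₀, hc₀, hneg⟩ := exists_quadForm_minimalOp_dilate_neg d hq2 hμ f hf
  -- The exponent `i + 1` makes every factor, including the first, strictly smaller than `c₀`.
  have hc : ∀ i : ℕ, 0 < c₀ / 2 ^ (i + 1) := fun i => by positivity
  let g : ℕ → 𝓓(halfLine, ℂ) := fun i => f.dilate (hc i)
  have hmem : ∀ i s, s ∈ tsupport (g i) → c₀ / 2 ^ (i + 1) * s ∈ Icc (1 : ℝ) (3 / 2) :=
    fun i s hs => hfs (tsupport_comp_subset_preimage f (continuous_const.mul continuous_id) hs)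
  have hdisj' : ∀ i k, i < k → Disjoint (tsupport (g i)) (tsupport (g k)) := by
    intro i k hik
    rw [Set.disjoint_left]
    intro s hi hk
    have h1 := (hmem i s hi).2
    have h2 := (hmem k s hk).1
    have hs : 0 < s := (g i).pos_of_mem hi
    -- A common point `s` would satisfy `1 ≤ c_k s ≤ c_i s / 2 ≤ 3/4`, where `c_i` is the factor `c₀
    -- / 2 ^ (i + 1)`.
    have h3 : c₀ / 2 ^ (k + 1) ≤ c₀ / 2 ^ (i + 1) / 2 := by
      rw [div_div, ← pow_succ]
      exact div_le_div_of_nonneg_left hc₀.le (by positivity)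
        (pow_le_pow_right₀ one_le_two (by omega))
    have h4 := mul_le_mul_of_nonneg_right h3 hs.le
    linarith
  have hdisj : ∀ i k, i ≠ k → Disjoint (tsupport (g i)) (tsupport (g k)) := fun i k hik =>
    hik.lt_or_gt.elim (hdisj' i k) fun h => (hdisj' k i h).symm
  refine ⟨fun i => ⟨testToL2 (g i), ⟨g i, rfl⟩⟩, fun i k hik => ?_, fun i k hik => ?_,
    fun i => hneg _ (hc i) (div_lt_self hc₀ (one_lt_pow₀ one_lt_two (by omega)))⟩
  · exact inner_testToL2_eq_zero (hdisj i k (Fin.val_ne_of_ne hik))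
  · change inner ℂ (testToL2 (g i)) (minimalOp d q μ ⟨testToL2 (g k), ⟨g k, rfl⟩⟩) = 0
    rw [minimalOp_apply]
    exact inner_testToL2_schrodingerToL2_eq_zero d q μ (hdisj i k (Fin.val_ne_of_ne hik))

end NegativeDirections

end

theorem lemmaA4 {d : ℕ} (hd : 2 ≤ d) {q : ℝ} (hq1 : 1 < q) (hq2 : q < 2) {μ : ℝ} (hμ : 0 < μ) :
    {E : ℝ | E < 0 ∧ (peakOp hd hq1 hq2 hμ).HasEigenvalue (E : ℂ)}.Infinite :=
  (minimalOp_isSemibounded hd hq1 hq2 hμ).infinite_negative_eigenvalues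
    (fun _ hε => exists_minimalOp_quadForm_lower_bound hd hq1 hq2 hμ hε)
    (exists_orthogonal_quadForm_minimalOp_neg d hq2 hμ)
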